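/- Let $M$ be a $4n$-dimensional almost quaternion-Hermitian manifold: a smooth Riemannian manifold with metric $g=\langle\cdot,\cdot\rangle$ and a rank-three subbundle $\mathcal G\subset\operatorname{End}TM$ which locally has an adapted basis, i.e. smooth local sections $I,J,K$ spanning $\mathcal G$ with $I^2=J^2=-1$, $K=IJ=-JI$ and $\langle AX,AY\rangle=\langle X,Y\rangle$ for $A=I,J,K$. Conventions. Put $\omega_A(X,Y)=\langle X,AY\rangle$ for $A=I,J,K$. For a $(0,s)$-tensor $\psi$ put $A_{(i)}\psi(X_1,\dots,X_s)=-\psi(X_1,\dots,AX_i,\dots,X_s)$, $A_{(ij)}=A_{(i)}A_{(j)}$, and $A\psi(X_1,\dots,X_s)=(-1)^s\psi(AX_1,\dots,AX_s)$. The inner product of $p$-forms is $\langle a,b\rangle=\frac1{p!}\sum a(e_{i_1},\dots,e_{i_p})\,b(e_{i_1},\dots,e_{i_p})$, the sum being over all indices for an orthonormal basis $(e_i)$, and for a three-form $\beta$ let $\Lambda_A\beta$ be the one-form $X\mapsto\langle X\lrcorner\beta,\omega_A\rangle$. Let $\nabla^{LC}$ be the Levi-Civita connection, $(\nabla^{LC}\omega_I)(X,Y,Z)=(\nabla^{LC}_X\omega_I)(Y,Z)$,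 and let $$\lambda_I(X)=\tfrac1{2n}\langle\nabla^{LC}_X\omega_J,\omega_K\rangle .$$ Let $N_I(X,Y,Z)=\langle X,N_I(Y,Z)\rangle$, where $N_I(Y,Z)=[Y,Z]+I[IY,Z]+I[Y,IZ]-[IY,IZ]$. A real three-form is of type $\{2,1\}=(2,1)+(1,2)$ with respect to $I$ if the $(3,0)$ and $(0,3)$ components of its complexification vanish; the space of such forms is denoted $\mathcal W_{3+4,I}$. Proposition. For every adapted basis $I,J,K$ of $\mathcal G$ over an open set $U\subset M$, the following hold on $U$. (1) The covariant derivative of $\omega_I$ is given by $$\begin{aligned}2\nabla^{LC}\omega_I&=(1-I_{(23)})\,d\omega_I+(I_{(2)}+I_{(3)})J_{(1)}\,d\omega_J-(1-I_{(23)})J_{(1)}\,d\omega_K\\&=(1-I_{(23)})\,d\omega_I+(I_{(2)}+I_{(3)})K_{(1)}\,d\omega_K+(1-I_{(23)})K_{(1)}\,d\omega_J .\end{aligned}$$ (2) The Nijenhuis $(0,3)$-tensor is given by $$\begin{aligned}2N_I&=(I_{(12)}+I_{(13)}+I_{(23)}-1)J_{(23)}(J\,d\omega_J-K\,d\omega_K)\\&=(1-I_{(12)})(K_{(23)}-J_{(23)})(J\,d\omega_J-K\,d\omega_K).\end{aligned}$$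 (3) The one-form $I\lambda_I$ is given by $$\begin{aligned}2n\,I\lambda_I&=I\Lambda_K d\omega_J+J\Lambda_K d\omega_I+J\Lambda_I d\omega_K\\&=I\Lambda_K d\omega_J+\Lambda_I d\omega_I-\Lambda_K d\omega_K .\end{aligned}$$ (4) $J\,d\omega_J+K\,d\omega_K\in\mathcal W_{3+4,I}$, i.e. this three-form is of type $\{2,1\}$ with respect to $I$, and $$(I_{(12)}+I_{(13)}+I_{(23)})(J\,d\omega_J+K\,d\omega_K)=J\,d\omega_J+K\,d\omega_K .$$ The corresponding statements for $J$ and $K$, obtained by cyclically permuting $I,J,K$, hold as well. -/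

import Mathlib

open Bundle VectorField
open scoped Manifold ContDiff

namespace QuaternionHermitian

noncomputable section

set_option linter.unusedSectionVars false

/-! ### Algebra of `(0,s)`-tensors on a vector space

A `(0,s)`-tensor on `V` is handled through its values on `s` vectors, i.e. as a function
`(Fin s → V) → ℝ`.  The argument slots are numbered from `0`. -/

section Algebra

variable {V : Type*} [AddCommGroup V] [Module ℝ V] [TopologicalSpace V] {s : ℕ}

/-- The operator `ψ ↦ - ψ(…, A Xᵢ, …)` on `(0,3)`-tensors, with `A` inserted in slot `i`. -/
def slot (A : V →L[ℝ] V) (i : Fin 3) : Module.End ℝ ((Fin 3 → V) → ℝ) where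
  toFun ψ := fun X ↦ - ψ (Function.update X i (A (X i)))
  map_add' ψ φ := by ext X; simp [add_comm]
  map_smul' c ψ := by ext X; simp

/-- The operator `ψ ↦ (-1)^s ψ(A X₁, …, A X_s)`. -/
def act (A : V →L[ℝ] V) : Module.End ℝ ((Fin s → V) → ℝ) where
  toFun ψ := fun X ↦ (-1) ^ s * ψ (fun i ↦ A (X i))
  map_add' ψ φ := by ext X; simp [mul_add]
  map_smul' c ψ := by ext X; simp [mul_left_comm]

/-- The sum `A₍₁₂₎ + A₍₁₃₎ + A₍₂₃₎` of compositions of slot operators, on `(0,3)`-tensors. -/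
def pairSum (A : V →L[ℝ] V) : Module.End ℝ ((Fin 3 → V) → ℝ) :=
  slot A 0 * slot A 1 + slot A 0 * slot A 2 + slot A 1 * slot A 2

/-- The inner product `⟨a, b⟩ = (1 / p!) ∑ a(e_{i₁}, …, e_{i_p}) b(e_{i₁}, …, e_{i_p})` of
`p`-forms, with `e` an orthonormal basis. -/
def formInner {V : Type*} [NormedAddCommGroup V] [InnerProductSpace ℝ V] [FiniteDimensional ℝ V]
    {s : ℕ} (a b : (Fin s → V) → ℝ) : ℝ :=
  (1 / (s.factorial : ℝ)) * ∑ f : Fin s → Fin (Module.finrank ℝ V),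
    a (fun i ↦ stdOrthonormalBasis ℝ V (f i)) * b (fun i ↦ stdOrthonormalBasis ℝ V (f i))

/-- The insertion `X ⌟ ψ` of `X` in the first slot. -/
def insertFirst {V : Type*} {s : ℕ} (X : V) (ψ : (Fin (s + 1) → V) → ℝ) : (Fin s → V) → ℝ :=
  fun Y ↦ ψ (Fin.cons X Y)

/-- The contraction `Λ β = ⟨· ⌟ β, η⟩` of a three-form `β` with a two-form `η`. -/
def contract {V : Type*} [NormedAddCommGroup V] [InnerProductSpace ℝ V] [FiniteDimensional ℝ V]
    (η : (Fin 2 → V) → ℝ) (β : (Fin 3 → V) → ℝ) :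
    (Fin 1 → V) → ℝ :=
  fun X ↦ formInner (insertFirst (X 0) β) η

/-- The function `ψ` is a three-form of type `{2,1} = (2,1) + (1,2)` with respect to `A`: it is
alternating and its complex multilinear extension vanishes on all triples of `(1,0)`-vectors
`X - i A X`, equivalently (as `ψ` is real) of `(0,1)`-vectors.  The sum below is the expansion of
`ψ(X₁ - i A X₁, X₂ - i A X₂, X₃ - i A X₃)`. -/
def IsTypeTwoOne (A : V →L[ℝ] V) (ψ : (Fin 3 → V) → ℝ) : Prop :=
  (∃ β : V [⋀^Fin 3]→ₗ[ℝ] ℝ, ψ = β) ∧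
    ∀ X : Fin 3 → V, ∑ S : Finset (Fin 3),
      (-Complex.I) ^ S.card * (ψ (S.piecewise (fun i ↦ A (X i)) X) : ℂ) = 0

end Algebra

/-! ### The Levi-Civita connection of a Riemannian manifold -/

section LeviCivita

variable {E : Type*} [NormedAddCommGroup E] [NormedSpace ℝ E] [FiniteDimensional ℝ E]
  {M : Type*} [TopologicalSpace M] [ChartedSpace E M] [IsManifold 𝓘(ℝ, E) ∞ M]
  [RiemannianBundle (fun x : M ↦ TangentSpace 𝓘(ℝ, E) x)]
  [IsContMDiffRiemannianBundle 𝓘(ℝ, E) ∞ E (fun x : M ↦ TangentSpace 𝓘(ℝ, E) x)]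

instance tangentSpace_finiteDimensional (x : M) :
    FiniteDimensional ℝ (TangentSpace 𝓘(ℝ, E) x) :=
  inferInstanceAs (FiniteDimensional ℝ E)

/-- The expression for `⟨∇_X Y, Z⟩` at the point `x` given by the Koszul formula. -/
def koszul (Y X Z : Π x : M, TangentSpace 𝓘(ℝ, E) x) (x : M) : ℝ :=
  (1 / 2) *
    (mvfderiv 𝓘(ℝ, E) (fun y ↦ inner ℝ (Y y) (Z y)) x (X x)
      + mvfderiv 𝓘(ℝ, E) (fun y ↦ inner ℝ (Z y) (X y)) x (Y x)
      - mvfderiv 𝓘(ℝ, E) (fun y ↦ inner ℝ (X y) (Y y)) x (Z x)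
      + inner ℝ (mlieBracket 𝓘(ℝ, E) X Y x) (Z x)
      - inner ℝ (mlieBracket 𝓘(ℝ, E) Y Z x) (X x)
      - inner ℝ (mlieBracket 𝓘(ℝ, E) X Z x) (Y x))

variable {X Y Z : Π x : M, TangentSpace 𝓘(ℝ, E) x} {x : M}

lemma mdifferentiableAt_inner (hX : MDiffAt (T% X) x) (hY : MDiffAt (T% Y) x) :
    MDifferentiableAt 𝓘(ℝ, E) 𝓘(ℝ, ℝ) (fun y ↦ inner ℝ (X y) (Y y)) x :=
  MDifferentiableAt.inner_bundle (E := fun x : M ↦ TangentSpace 𝓘(ℝ, E) x) hX hY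

lemma koszul_tensorial_left (hY : MDiffAt (T% Y) x) (hZ : MDiffAt (T% Z) x) :
    TensorialAt 𝓘(ℝ, E) E (fun X ↦ koszul Y X Z x) x where
  smul {f σ} hf hσ := by
    have h1 : (fun y ↦ inner ℝ (Z y) ((f • σ) y)) = f * fun y ↦ inner ℝ (Z y) (σ y) := by
      ext y; simp [inner_smul_right]
    have h2 : (fun y ↦ inner ℝ ((f • σ) y) (Y y)) = f * fun y ↦ inner ℝ (σ y) (Y y) := by
      ext y; simp [inner_smul_left]
    simp only [koszul, h1, h2, mvfderiv_mul hf (mdifferentiableAt_inner hZ hσ),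
      mvfderiv_mul hf (mdifferentiableAt_inner hσ hY), mlieBracket_smul_left hf hσ]
    simp [inner_add_left, inner_smul_left, inner_smul_right, real_inner_comm]
    ring
  add {σ σ'} hσ hσ' := by
    have h1 : (fun y ↦ inner ℝ (Z y) ((σ + σ') y)) =
        (fun y ↦ inner ℝ (Z y) (σ y)) + fun y ↦ inner ℝ (Z y) (σ' y) := by
      ext y; simp [inner_add_right]
    have h2 : (fun y ↦ inner ℝ ((σ + σ') y) (Y y)) =
        (fun y ↦ inner ℝ (σ y) (Y y)) + fun y ↦ inner ℝ (σ' y) (Y y) := by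
      ext y; simp [inner_add_left]
    simp only [koszul, h1, h2, mvfderiv_add (mdifferentiableAt_inner hZ hσ) (mdifferentiableAt_inner hZ hσ'),
      mvfderiv_add (mdifferentiableAt_inner hσ hY) (mdifferentiableAt_inner hσ' hY), mlieBracket_add_left hσ hσ']
    simp [inner_add_left, inner_add_right]
    ring

lemma koszul_tensorial_right (hY : MDiffAt (T% Y) x) (hX : MDiffAt (T% X) x) :
    TensorialAt 𝓘(ℝ, E) E (fun Z ↦ koszul Y X Z x) x where
  smul {f σ} hf hσ := by
    have h1 : (fun y ↦ inner ℝ (Y y) ((f • σ) y)) = f * fun y ↦ inner ℝ (Y y) (σ y) := by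
      ext y; simp [inner_smul_right]
    have h2 : (fun y ↦ inner ℝ ((f • σ) y) (X y)) = f * fun y ↦ inner ℝ (σ y) (X y) := by
      ext y; simp [inner_smul_left]
    simp only [koszul, h1, h2, mvfderiv_mul hf (mdifferentiableAt_inner hY hσ),
      mvfderiv_mul hf (mdifferentiableAt_inner hσ hX), mlieBracket_smul_right hf hσ]
    simp [inner_add_left, inner_smul_left, inner_smul_right, real_inner_comm]
    ring
  add {σ σ'} hσ hσ' := by
    have h1 : (fun y ↦ inner ℝ (Y y) ((σ + σ') y)) =
        (fun y ↦ inner ℝ (Y y) (σ y)) + fun y ↦ inner ℝ (Y y) (σ' y) := by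
      ext y; simp [inner_add_right]
    have h2 : (fun y ↦ inner ℝ ((σ + σ') y) (X y)) =
        (fun y ↦ inner ℝ (σ y) (X y)) + fun y ↦ inner ℝ (σ' y) (X y) := by
      ext y; simp [inner_add_left]
    simp only [koszul, h1, h2, mvfderiv_add (mdifferentiableAt_inner hY hσ) (mdifferentiableAt_inner hY hσ'),
      mvfderiv_add (mdifferentiableAt_inner hσ hX) (mdifferentiableAt_inner hσ' hX), mlieBracket_add_right hσ hσ']
    simp [inner_add_left, inner_add_right]
    ring

open Classical in
/-- The bilinear form `(X, Z) ↦ ⟨∇_X Y, Z⟩` at `x` given by the Koszul formula. -/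
def koszulForm (Y : Π x : M, TangentSpace 𝓘(ℝ, E) x) (x : M) :
    TangentSpace 𝓘(ℝ, E) x →L[ℝ] TangentSpace 𝓘(ℝ, E) x →L[ℝ] ℝ :=
  if hY : MDiffAt (T% Y) x then
    TensorialAt.mkHom₂ (fun X Z ↦ koszul Y X Z x) x
      (fun _ hZ ↦ koszul_tensorial_left hY hZ) (fun _ hX ↦ koszul_tensorial_right hY hX)
  else 0

lemma koszulForm_apply (hX : MDiffAt (T% X) x) (hY : MDiffAt (T% Y) x) (hZ : MDiffAt (T% Z) x) :
    koszulForm Y x (X x) (Z x) = koszul Y X Z x := by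
  rw [koszulForm, dif_pos hY, TensorialAt.mkHom₂_apply _ _ hX hZ]

/-- The vector `∇_X Y` at `x`, as a function of `Y` and of `X` at `x`. -/
def leviCivitaFun (Y : Π x : M, TangentSpace 𝓘(ℝ, E) x) (x : M) :
    TangentSpace 𝓘(ℝ, E) x →L[ℝ] TangentSpace 𝓘(ℝ, E) x :=
  ∑ i, ((koszulForm Y x).flip (stdOrthonormalBasis ℝ (TangentSpace 𝓘(ℝ, E) x) i)).smulRight
    (stdOrthonormalBasis ℝ (TangentSpace 𝓘(ℝ, E) x) i)

lemma inner_leviCivitaFun (Y : Π x : M, TangentSpace 𝓘(ℝ, E) x) (x : M)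
    (v w : TangentSpace 𝓘(ℝ, E) x) :
    inner ℝ (leviCivitaFun Y x v) w = koszulForm Y x v w := by
  conv_rhs => rw [← (stdOrthonormalBasis ℝ (TangentSpace 𝓘(ℝ, E) x)).sum_repr' w, map_sum]
  simp [leviCivitaFun, sum_inner, inner_smul_left, mul_comm]

lemma inner_leviCivitaFun_apply (hX : MDiffAt (T% X) x) (hY : MDiffAt (T% Y) x)
    (hZ : MDiffAt (T% Z) x) : inner ℝ (leviCivitaFun Y x (X x)) (Z x) = koszul Y X Z x := by
  rw [inner_leviCivitaFun, koszulForm_apply hX hY hZ]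

lemma ext_of_inner_sections {A B : TangentSpace 𝓘(ℝ, E) x →L[ℝ] TangentSpace 𝓘(ℝ, E) x}
    (h : ∀ X Z : Π x : M, TangentSpace 𝓘(ℝ, E) x, MDiffAt (T% X) x → MDiffAt (T% Z) x →
      (inner ℝ (A (X x)) (Z x) : ℝ) = inner ℝ (B (X x)) (Z x)) : A = B := by
  ext1 v
  refine ext_inner_right ℝ fun w ↦ ?_
  simpa using h (FiberBundle.extend E v) (FiberBundle.extend E w)
    (FiberBundle.mdifferentiableAt_extend ..) (FiberBundle.mdifferentiableAt_extend ..)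

/-- The Levi-Civita connection, constructed from the Koszul formula. -/
def leviCivita : CovariantDerivative 𝓘(ℝ, E) E (fun x : M ↦ TangentSpace 𝓘(ℝ, E) x) where
  toFun := leviCivitaFun
  isCovariantDerivativeOnUniv :=
    { add := by
        intro σ σ' x hσ hσ' _
        refine ext_of_inner_sections fun X Z hX hZ ↦ ?_
        have hs : MDiffAt (T% (σ + σ')) x := mdifferentiableAt_add_section hσ hσ'
        have h1 : (fun y ↦ inner ℝ ((σ + σ') y) (Z y)) =
            (fun y ↦ inner ℝ (σ y) (Z y)) + fun y ↦ inner ℝ (σ' y) (Z y) := by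
          ext y; simp [inner_add_left]
        have h2 : (fun y ↦ inner ℝ (X y) ((σ + σ') y)) =
            (fun y ↦ inner ℝ (X y) (σ y)) + fun y ↦ inner ℝ (X y) (σ' y) := by
          ext y; simp [inner_add_right]
        rw [add_apply, inner_add_left, inner_leviCivitaFun_apply hX hs hZ,
          inner_leviCivitaFun_apply hX hσ hZ, inner_leviCivitaFun_apply hX hσ' hZ]
        simp only [koszul, h1, h2,
          mvfderiv_add (mdifferentiableAt_inner hσ hZ) (mdifferentiableAt_inner hσ' hZ),
          mvfderiv_add (mdifferentiableAt_inner hX hσ) (mdifferentiableAt_inner hX hσ'),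
          mlieBracket_add_right hσ hσ', mlieBracket_add_left hσ hσ']
        simp [inner_add_left, inner_add_right]
        ring
      leibniz := by
        intro σ f x hσ hf _
        refine ext_of_inner_sections fun X Z hX hZ ↦ ?_
        have hs : MDiffAt (T% (f • σ)) x := hf.smul_section hσ
        have h1 : (fun y ↦ inner ℝ ((f • σ) y) (Z y)) = f * fun y ↦ inner ℝ (σ y) (Z y) := by
          ext y; simp [inner_smul_left]
        have h2 : (fun y ↦ inner ℝ (X y) ((f • σ) y)) = f * fun y ↦ inner ℝ (X y) (σ y) := by
          ext y; simp [inner_smul_right]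
        rw [add_apply, smul_apply, inner_add_left,
          inner_smul_left, inner_leviCivitaFun_apply hX hs hZ, inner_leviCivitaFun_apply hX hσ hZ]
        simp only [koszul, h1, h2, mvfderiv_mul hf (mdifferentiableAt_inner hσ hZ),
          mvfderiv_mul hf (mdifferentiableAt_inner hX hσ),
          mlieBracket_smul_right hf hσ, mlieBracket_smul_left hf hσ]
        simp [inner_add_left, inner_smul_left, inner_smul_right, real_inner_comm]
        ring }

lemma inner_leviCivita_apply (hX : MDiffAt (T% X) x) (hY : MDiffAt (T% Y) x)
    (hZ : MDiffAt (T% Z) x) : inner ℝ (leviCivita Y x (X x)) (Z x) = koszul Y X Z x :=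
  inner_leviCivitaFun_apply hX hY hZ

theorem leviCivita_torsion :
    (leviCivita : CovariantDerivative 𝓘(ℝ, E) E (fun x : M ↦ TangentSpace 𝓘(ℝ, E) x)).torsion
      = 0 := by
  rw [CovariantDerivative.torsion_eq_zero_iff]
  intro X Y x hX hY
  refine ext_inner_right ℝ fun w ↦ ?_
  have hw : MDiffAt (T% (FiberBundle.extend E w)) x := FiberBundle.mdifferentiableAt_extend ..
  rw [← FiberBundle.extend_apply_self E w, inner_sub_left, inner_leviCivita_apply hX hY hw,
    inner_leviCivita_apply hY hX hw, koszul, koszul, mlieBracket_swap_apply (V := Y) (W := X)]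
  simp [real_inner_comm]
  ring

theorem leviCivita_metric (hX : MDiffAt (T% X) x) (hY : MDiffAt (T% Y) x)
    (hZ : MDiffAt (T% Z) x) :
    mvfderiv 𝓘(ℝ, E) (fun y ↦ inner ℝ (Y y) (Z y)) x (X x) =
      inner ℝ (leviCivita Y x (X x)) (Z x) + inner ℝ (Y x) (leviCivita Z x (X x)) := by
  rw [real_inner_comm (leviCivita Z x (X x)), inner_leviCivita_apply hX hY hZ,
    inner_leviCivita_apply hX hZ hY, koszul, koszul, mlieBracket_swap_apply (V := Z) (W := Y)]
  simp [real_inner_comm]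
  ring

end LeviCivita

/-! ### Differential operators on a Riemannian manifold -/

section Operators

variable {E : Type*} [NormedAddCommGroup E] [NormedSpace ℝ E] [FiniteDimensional ℝ E]
  {M : Type*} [TopologicalSpace M] [ChartedSpace E M]

/-- The exterior derivative of a differential form on a manifold: at `x`, the form is pulled back
to the model space by the inverse of the chart at `x`, differentiated there, and the result is
pulled back by the chart. -/
def extDer {k : ℕ} (η : Π x : M, TangentSpace 𝓘(ℝ, E) x [⋀^Fin k]→L[ℝ] ℝ) (x : M) :
    TangentSpace 𝓘(ℝ, E) x [⋀^Fin (k + 1)]→L[ℝ] ℝ :=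
  ContinuousAlternatingMap.compContinuousLinearMap
    (extDeriv (fun y : E ↦ ((η ((extChartAt 𝓘(ℝ, E) x).symm y)).compContinuousLinearMap
        (mfderiv 𝓘(ℝ, E) 𝓘(ℝ, E) (extChartAt 𝓘(ℝ, E) x).symm y) : E [⋀^Fin k]→L[ℝ] ℝ))
      (extChartAt 𝓘(ℝ, E) x x))
    (mfderiv 𝓘(ℝ, E) 𝓘(ℝ, E) (extChartAt 𝓘(ℝ, E) x) x)

variable [IsManifold 𝓘(ℝ, E) ∞ M]

/-- The Nijenhuis tensor `N(X, Y) = [X, Y] + A[AX, Y] + A[X, AY] - [AX, AY]` of a field `A` of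
endomorphisms, evaluated on tangent vectors `v`, `w` at `x` by extending them to vector fields that
are smooth near `x`. -/
def nijenhuis (A : Π x : M, TangentSpace 𝓘(ℝ, E) x →L[ℝ] TangentSpace 𝓘(ℝ, E) x) (x : M)
    (v w : TangentSpace 𝓘(ℝ, E) x) : TangentSpace 𝓘(ℝ, E) x :=
  let X : Π y : M, TangentSpace 𝓘(ℝ, E) y := FiberBundle.extend E v
  let Y : Π y : M, TangentSpace 𝓘(ℝ, E) y := FiberBundle.extend E w
  mlieBracket 𝓘(ℝ, E) X Y x + A x (mlieBracket 𝓘(ℝ, E) (fun y ↦ A y (X y)) Y x)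
    + A x (mlieBracket 𝓘(ℝ, E) X (fun y ↦ A y (Y y)) x)
    - mlieBracket 𝓘(ℝ, E) (fun y ↦ A y (X y)) (fun y ↦ A y (Y y)) x

variable [RiemannianBundle (fun x : M ↦ TangentSpace 𝓘(ℝ, E) x)]

/-- The Nijenhuis `(0,3)`-tensor `N(X, Y, Z) = ⟨X, N(Y, Z)⟩`. -/
def nijenhuis₃ (A : Π x : M, TangentSpace 𝓘(ℝ, E) x →L[ℝ] TangentSpace 𝓘(ℝ, E) x) (x : M) :
    (Fin 3 → TangentSpace 𝓘(ℝ, E) x) → ℝ :=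
  fun v ↦ inner ℝ (v 0) (nijenhuis A x (v 1) (v 2))

/-- The Kähler form `ω_A(X, Y) = ⟨X, AY⟩` of a field of skew-symmetric endomorphisms, see
`kahlerForm_apply`.  (For an arbitrary `A` this is the form of its skew-symmetric part.) -/
def kahlerForm (A : Π x : M, TangentSpace 𝓘(ℝ, E) x →L[ℝ] TangentSpace 𝓘(ℝ, E) x) (x : M) :
    TangentSpace 𝓘(ℝ, E) x [⋀^Fin 2]→L[ℝ] ℝ where
  toFun v := (1 / 2) * (inner ℝ (v 0) (A x (v 1)) - inner ℝ (v 1) (A x (v 0)))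
  map_update_add' v i X Y := by
    fin_cases i <;> simp [inner_add_left, inner_add_right] <;> ring
  map_update_smul' v i c X := by
    fin_cases i <;> simp [inner_smul_left, inner_smul_right] <;> ring
  cont := by fun_prop
  map_eq_zero_of_eq' v i j h hij := by
    have : v 0 = v 1 := by fin_cases i <;> fin_cases j <;> simp_all
    simp [this]

lemma kahlerForm_apply {A : Π x : M, TangentSpace 𝓘(ℝ, E) x →L[ℝ] TangentSpace 𝓘(ℝ, E) x} {x : M}
    (hA : ∀ v, A x (A x v) = -v)
    (hA' : ∀ v w, (inner ℝ (A x v) (A x w) : ℝ) = inner ℝ v w)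
    (v w : TangentSpace 𝓘(ℝ, E) x) : kahlerForm A x ![v, w] = inner ℝ v (A x w) := by
  have h : (inner ℝ w (A x v) : ℝ) = - inner ℝ v (A x w) := by
    rw [← hA' w (A x v), hA, inner_neg_right, real_inner_comm]
  change (1 / 2 : ℝ) * (inner ℝ v (A x w) - inner ℝ w (A x v)) = _
  rw [h]; ring

variable [IsContMDiffRiemannianBundle 𝓘(ℝ, E) ∞ E (fun x : M ↦ TangentSpace 𝓘(ℝ, E) x)]

/-- The covariant derivative `(X, Y, Z) ↦ (∇_X η)(Y, Z)` of a two-form with respect to the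
Levi-Civita connection, i.e. `X(η(Y, Z)) - η(∇_X Y, Z) - η(Y, ∇_X Z)`, evaluated on tangent vectors
at `x` by extending them to vector fields that are smooth near `x`. -/
def nablaForm (η : Π x : M, TangentSpace 𝓘(ℝ, E) x [⋀^Fin 2]→L[ℝ] ℝ) (x : M) :
    (Fin 3 → TangentSpace 𝓘(ℝ, E) x) → ℝ :=
  fun v ↦
    let Y : Π y : M, TangentSpace 𝓘(ℝ, E) y := FiberBundle.extend E (v 1)
    let Z : Π y : M, TangentSpace 𝓘(ℝ, E) y := FiberBundle.extend E (v 2)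
    mvfderiv 𝓘(ℝ, E) (fun y ↦ η y ![Y y, Z y]) x (v 0)
      - η x ![leviCivita Y x (v 0), v 2] - η x ![v 1, leviCivita Z x (v 0)]

end Operators

/-! ### Almost quaternion-Hermitian manifolds -/

section AlmostQuaternionHermitian

variable {n : ℕ} {M : Type*} [TopologicalSpace M]
  [ChartedSpace (EuclideanSpace ℝ (Fin (4 * n))) M]
  [IsManifold (𝓡 (4 * n)) ∞ M]

/-- Fields of endomorphisms of the tangent spaces of a `4n`-dimensional manifold. -/
abbrev EndField (n : ℕ) (M : Type*) [TopologicalSpace M]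
    [ChartedSpace (EuclideanSpace ℝ (Fin (4 * n))) M] :=
  Π x : M, TangentSpace (𝓡 (4 * n)) x →L[ℝ]
    TangentSpace (𝓡 (4 * n)) x

/-- The field `A` of endomorphisms is smooth on `U`. -/
def SmoothEndOn (A : EndField n M) (U : Set M) : Prop :=
  ContMDiffOn (𝓡 (4 * n))
    ((𝓡 (4 * n)).prod
      𝓘(ℝ, EuclideanSpace ℝ (Fin (4 * n)) →L[ℝ] EuclideanSpace ℝ (Fin (4 * n)))) ∞
    (fun x ↦ TotalSpace.mk'
      (EuclideanSpace ℝ (Fin (4 * n)) →L[ℝ] EuclideanSpace ℝ (Fin (4 * n)))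
      (E := fun x : M ↦ TangentSpace (𝓡 (4 * n)) x →L[ℝ]
        TangentSpace (𝓡 (4 * n)) x) x (A x)) U

variable [RiemannianBundle (fun x : M ↦ TangentSpace (𝓡 (4 * n)) x)]

/-- `I, J, K` is an adapted basis over the open set `U` of the family `G` of spaces of
endomorphisms. -/
structure IsAdaptedBasis
    (G : Π x : M, Submodule ℝ (TangentSpace (𝓡 (4 * n)) x →L[ℝ]
      TangentSpace (𝓡 (4 * n)) x))
    (U : Set M) (I J K : EndField n M) : Prop where
  isOpen : IsOpen U
  smooth : ∀ A ∈ ({I, J, K} : Set (EndField n M)), SmoothEndOn A U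
  span : ∀ x ∈ U, G x = Submodule.span ℝ {I x, J x, K x}
  sq_I : ∀ x ∈ U, I x ∘L I x = - ContinuousLinearMap.id ℝ _
  sq_J : ∀ x ∈ U, J x ∘L J x = - ContinuousLinearMap.id ℝ _
  K_eq : ∀ x ∈ U, K x = I x ∘L J x
  anticomm : ∀ x ∈ U, I x ∘L J x = - (J x ∘L I x)
  orthogonal : ∀ A ∈ ({I, J, K} : Set (EndField n M)), ∀ x ∈ U, ∀ X Y,
    (inner ℝ (A x X) (A x Y) : ℝ) = inner ℝ X Y

/-- An almost quaternion-Hermitian structure on a Riemannian `4n`-manifold: a rank three subbundle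
of the endomorphism bundle of the tangent bundle which locally has adapted bases. -/
structure AlmostQuaternionHermitian (n : ℕ) (M : Type*) [TopologicalSpace M]
    [ChartedSpace (EuclideanSpace ℝ (Fin (4 * n))) M]
    [IsManifold (𝓡 (4 * n)) ∞ M]
    [RiemannianBundle (fun x : M ↦ TangentSpace (𝓡 (4 * n)) x)] where
  G : Π x : M, Submodule ℝ (TangentSpace (𝓡 (4 * n)) x →L[ℝ]
    TangentSpace (𝓡 (4 * n)) x)
  rank_eq : ∀ x, Module.finrank ℝ (G x) = 3
  exists_adapted : ∀ x, ∃ (U : Set M) (I J K : EndField n M), x ∈ U ∧ IsAdaptedBasis G U I J K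

variable [IsContMDiffRiemannianBundle (𝓡 (4 * n)) ∞
  (EuclideanSpace ℝ (Fin (4 * n)))
  (fun x : M ↦ TangentSpace (𝓡 (4 * n)) x)]

/-- The Kähler form of `A` at `x`, as a `(0,2)`-tensor. -/
def kahler (A : EndField n M) (x : M) :
    (Fin 2 → TangentSpace (𝓡 (4 * n)) x) → ℝ :=
  kahlerForm A x

/-- The exterior derivative of the Kähler form of `A` at `x`, as a `(0,3)`-tensor. -/
def dKahler (A : EndField n M) (x : M) :
    (Fin 3 → TangentSpace (𝓡 (4 * n)) x) → ℝ :=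
  extDer (kahlerForm A) x

/-- The one-form `X ↦ (1 / 2n) ⟨∇_X ω_B, ω_C⟩`; this is `λ_I` for `B = J`, `C = K`. -/
def lambdaForm (B C : EndField n M) (x : M) :
    (Fin 1 → TangentSpace (𝓡 (4 * n)) x) → ℝ :=
  fun X ↦ (1 / (2 * n : ℝ)) *
    formInner (insertFirst (X 0) (nablaForm (kahlerForm B) x)) (kahler C x)

end AlmostQuaternionHermitian

end

end QuaternionHermitian

open QuaternionHermitian

/-!
Fix a point `x` of the domain of an adapted basis `I, J, K` and write `D_A = ∇A` for the covariant
derivative of `A = I, J, K`. Differentiating the quaternion relations between `I`, `J` and `K` shows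
that the one-form `θ = (I D_I + J D_J + K D_K) / 4` with values in the skew-symmetric endomorphisms
satisfies `D_A = [θ, A]` for `A = I, J, K` (`ProductRules.commutator`,
`isCommutatorTensor_of_productRules`). With `t(X, Y, Z) = ⟨Y, θ_X Z⟩`, which is skew in `Y, Z`,

* `(∇ω_A)(X, Y, Z) = ⟨Y, (∇_X A) Z⟩ = t(X, Y, AZ) + t(X, AY, Z)` (`nablaForm_kahlerForm`);
* `dω_A` is the cyclic sum of `∇ω_A` (`extDer_eq_cyclic_nablaForm`);
* the Nijenhuis tensor of `A` is a combination of values of `∇ω_A`, since the connection is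
  torsion-free (`nijenhuis₃_eq`).

All three are thus linear in a single tensor `t`, subject to no condition besides its skew symmetry.
The formulas for `∇ω_I` and `N_I` and the equation `(I₍₁₂₎ + I₍₁₃₎ + I₍₂₃₎) ψ = ψ` for
`ψ = J dω_J + K dω_K` follow by expanding both sides in the values of `t` at multiples of `X, Y, Z`
by `1, I, J, K`. That equation says that the `(3,0)` part of `ψ` vanishes
(`isTypeTwoOne_of_pairSum_eq`).

For the one-form `I λ_I`, contracting over an orthonormal basis and moving endomorphisms from one
argument to the other gives `Λ_A dω_B(X) = -u_{BA}(X) + v_{BA}(X) + v_A(BX)` (`contract_eq`) and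
`2n λ_I = -u_I`, where `u_r(X) = ∑ t(X, e, r e)` and `v_r(X) = ∑ t(e, X, r e)`; in both combinations
of contractions the terms other than `u_I(IX)` cancel.
-/

namespace QuaternionHermitian

/-! ### Evaluation of the tensor operators -/

section Evaluation

variable {V : Type*} [AddCommGroup V] [Module ℝ V] [TopologicalSpace V]

lemma slot_zero_apply (A : V →L[ℝ] V) (ψ : (Fin 3 → V) → ℝ) (X Y Z : V) :
    slot A 0 ψ ![X, Y, Z] = - ψ ![A X, Y, Z] := by
  change - ψ _ = _
  congr 2
  ext i; fin_cases i <;> simp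

lemma slot_one_apply (A : V →L[ℝ] V) (ψ : (Fin 3 → V) → ℝ) (X Y Z : V) :
    slot A 1 ψ ![X, Y, Z] = - ψ ![X, A Y, Z] := by
  change - ψ _ = _
  congr 2
  ext i; fin_cases i <;> simp

lemma slot_two_apply (A : V →L[ℝ] V) (ψ : (Fin 3 → V) → ℝ) (X Y Z : V) :
    slot A 2 ψ ![X, Y, Z] = - ψ ![X, Y, A Z] := by
  change - ψ _ = _
  congr 2
  ext i; fin_cases i <;> simp

lemma act_three_apply (A : V →L[ℝ] V) (ψ : (Fin 3 → V) → ℝ) (X Y Z : V) :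
    act A ψ ![X, Y, Z] = - ψ ![A X, A Y, A Z] := by
  change (-1) ^ 3 * ψ _ = _
  rw [show (fun i ↦ A (![X, Y, Z] i)) = ![A X, A Y, A Z] by ext i; fin_cases i <;> simp]
  ring

lemma act_one_apply (A : V →L[ℝ] V) (ψ : (Fin 1 → V) → ℝ) (X : Fin 1 → V) :
    act A ψ X = - ψ (fun _ ↦ A (X 0)) := by
  change (-1) ^ 1 * ψ _ = _
  rw [show (fun i ↦ A (X i)) = fun _ ↦ A (X 0) by ext i; fin_cases i; rfl]
  ring

lemma pairSum_apply (A : V →L[ℝ] V) (ψ : (Fin 3 → V) → ℝ) (X Y Z : V) :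
    pairSum A ψ ![X, Y, Z] =
      ψ ![A X, A Y, Z] + ψ ![A X, Y, A Z] + ψ ![X, A Y, A Z] := by
  simp [pairSum, slot_zero_apply, slot_one_apply, slot_two_apply]

omit [AddCommGroup V] [Module ℝ V] [TopologicalSpace V] in
lemma tensor_ext {ψ φ : (Fin 3 → V) → ℝ} (h : ∀ X Y Z, ψ ![X, Y, Z] = φ ![X, Y, Z]) :
    ψ = φ := by
  ext v
  have hv : v = ![v 0, v 1, v 2] := by ext i; fin_cases i <;> rfl
  rw [hv]; exact h _ _ _

lemma exists_alternatingMap_act (A : V →L[ℝ] V) (β : V [⋀^Fin 3]→ₗ[ℝ] ℝ) :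
    ∃ γ : V [⋀^Fin 3]→ₗ[ℝ] ℝ, act A (β : (Fin 3 → V) → ℝ) = γ := by
  refine ⟨-β.compLinearMap A.toLinearMap, ?_⟩
  ext v
  change (-1 : ℝ) ^ 3 * β _ = - β _
  norm_num [Function.comp_def]

/-- The vanishing of the real part of `ψ(X - iAX, Y - iAY, Z - iAZ)` is the equation `h` at
`(X, Y, Z)`, and that of the imaginary part is `h` at `(AX, Y, Z)`. -/
lemma isTypeTwoOne_of_pairSum_eq {A : V →L[ℝ] V} {ψ : (Fin 3 → V) → ℝ}
    (hA : ∀ v, A (A v) = -v) (hψ : ∃ β : V [⋀^Fin 3]→ₗ[ℝ] ℝ, ψ = β)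
    (h : pairSum A ψ = ψ) : IsTypeTwoOne A ψ := by
  refine ⟨hψ, fun X ↦ ?_⟩
  have hneg : ∀ x y z, ψ ![-x, y, z] = - ψ ![x, y, z] := by
    obtain ⟨β, rfl⟩ := hψ
    intro x y z
    have hu : ∀ w, Function.update ![x, y, z] 0 w = ![w, y, z] := fun w ↦ by
      ext i; fin_cases i <;> rfl
    simpa only [hu] using β.map_update_neg ![x, y, z] 0 x
  have re := congrFun h ![X 0, X 1, X 2]
  have im := congrFun h ![A (X 0), X 1, X 2]
  rw [pairSum_apply] at re im
  simp only [hA, hneg] at im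
  have huniv : (Finset.univ : Finset (Finset (Fin 3))) =
      {∅, {0}, {1}, {2}, {0, 1}, {0, 2}, {1, 2}, {0, 1, 2}} := by decide
  have hS : ∀ S : Finset (Fin 3), S.piecewise (fun i ↦ A (X i)) X =
      ![if 0 ∈ S then A (X 0) else X 0, if 1 ∈ S then A (X 1) else X 1,
        if 2 ∈ S then A (X 2) else X 2] := by
    intro S; ext i; fin_cases i <;> rfl
  simp only [hS, huniv]
  repeat rw [Finset.sum_insert (by decide)]
  rw [Finset.sum_singleton]
  have re' := congrArg (fun r : ℝ ↦ (r : ℂ)) re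
  have im' := congrArg (fun r : ℝ ↦ (r : ℂ)) im
  push_cast at re' im'
  simp [neg_pow Complex.I]
  linear_combination (-re' + Complex.I * im')

end Evaluation

/-! ### The identities between three-tensors -/

section TensorIdentities

variable {V : Type*} [AddCommGroup V] [Module ℝ V] [TopologicalSpace V]

/-- The relations between the endomorphisms `I`, `J`, `K` of an adapted basis, on vectors. -/
structure QuaternionRelations (I J K : V →L[ℝ] V) : Prop where
  II : ∀ v, I (I v) = -v
  JJ : ∀ v, J (J v) = -v
  KK : ∀ v, K (K v) = -v
  IJ : ∀ v, I (J v) = K v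
  JI : ∀ v, J (I v) = -K v
  JK : ∀ v, J (K v) = I v
  KJ : ∀ v, K (J v) = -I v
  KI : ∀ v, K (I v) = J v
  IK : ∀ v, I (K v) = -J v

lemma quaternionRelations_of_comp {I J K : V →L[ℝ] V} (hI : ∀ v, I (I v) = -v)
    (hJ : ∀ v, J (J v) = -v)
    (hK : ∀ v, K v = I (J v)) (hIJ : ∀ v, I (J v) = - J (I v)) : QuaternionRelations I J K where
  II := hI
  JJ := hJ
  KK v := by rw [hK, hK, ← neg_eq_iff_eq_neg.mpr (hIJ (J v)), hJ, map_neg, map_neg]; simp [hI]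
  IJ v := (hK v).symm
  JI v := by rw [hK, hIJ, neg_neg]
  JK v := by rw [hK, ← neg_eq_iff_eq_neg.mpr (hIJ (J v)), hJ, map_neg, neg_neg]
  KJ v := by rw [hK, hJ, map_neg]
  KI v := by rw [hK, hIJ, hI, map_neg, neg_neg]
  IK v := by rw [hK, hI]

lemma QuaternionRelations.rotate {I J K : V →L[ℝ] V} (h : QuaternionRelations I J K) :
    QuaternionRelations J K I :=
  ⟨h.JJ, h.KK, h.II, h.JK, h.KJ, h.KI, h.IK, h.IJ, h.JI⟩

/-- The `(0,3)`-tensor `a` is `(X, Y, Z) ↦ t(X, Y, AZ) + t(X, AY, Z)`, where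
`t(X, Y, Z) = s(X, Y, Z) - s(X, Z, Y)`, and `d` is its sum over cyclic permutations.  If
`t(X, Y, Z) = ⟨Y, θ_X Z⟩` for a one-form `θ` with values in the skew-symmetric endomorphisms, then
`a(X, Y, Z) = ⟨Y, [θ_X, A] Z⟩`; writing `t` as the skew part of `s` makes the tensor identities below
formal consequences of the quaternion relations. -/
structure IsCommutatorTensor (s : V →ₗ[ℝ] V →ₗ[ℝ] V →ₗ[ℝ] ℝ) (A : V →L[ℝ] V)
    (a d : (Fin 3 → V) → ℝ) : Prop where
  eq : ∀ X Y Z, a ![X, Y, Z] = s X Y (A Z) - s X (A Z) Y + s X (A Y) Z - s X Z (A Y)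
  cyc : ∀ X Y Z, d ![X, Y, Z] = a ![X, Y, Z] + a ![Y, Z, X] + a ![Z, X, Y]

variable {s : V →ₗ[ℝ] V →ₗ[ℝ] V →ₗ[ℝ] ℝ} {I J K : V →L[ℝ] V}
  {aI aJ aK dI dJ dK : (Fin 3 → V) → ℝ}

lemma two_nabla_eq (q : QuaternionRelations I J K) (hI : IsCommutatorTensor s I aI dI)
    (hJ : IsCommutatorTensor s J aJ dJ) (hK : IsCommutatorTensor s K aK dK) :
    (2 : ℝ) • aI = (1 - slot I 1 * slot I 2) dI + (slot I 1 + slot I 2) (slot J 0 dJ)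
      - (1 - slot I 1 * slot I 2) (slot J 0 dK) := by
  refine tensor_ext fun X Y Z ↦ ?_
  simp [slot_zero_apply, slot_one_apply, slot_two_apply, hI.cyc, hJ.cyc, hK.cyc, hI.eq, hJ.eq,
    hK.eq, q.II, q.JJ, q.JI, q.KJ, q.KI]
  ring

lemma two_nabla_eq' (q : QuaternionRelations I J K) (hI : IsCommutatorTensor s I aI dI)
    (hJ : IsCommutatorTensor s J aJ dJ) (hK : IsCommutatorTensor s K aK dK) :
    (2 : ℝ) • aI = (1 - slot I 1 * slot I 2) dI + (slot I 1 + slot I 2) (slot K 0 dK)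
      + (1 - slot I 1 * slot I 2) (slot K 0 dJ) := by
  refine tensor_ext fun X Y Z ↦ ?_
  simp [slot_zero_apply, slot_one_apply, slot_two_apply, hI.cyc, hJ.cyc, hK.cyc, hI.eq, hJ.eq,
    hK.eq, q.II, q.KK, q.JI, q.JK, q.KI]
  ring

lemma two_nijenhuis_eq (q : QuaternionRelations I J K) (hI : IsCommutatorTensor s I aI dI)
    (hJ : IsCommutatorTensor s J aJ dJ) (hK : IsCommutatorTensor s K aK dK)
    {N : (Fin 3 → V) → ℝ} (hN : ∀ X Y Z, N ![X, Y, Z] =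
      aI ![Z, I X, Y] - aI ![Y, I X, Z] - aI ![I Y, X, Z] + aI ![I Z, X, Y]) :
    (2 : ℝ) • N = (pairSum I - 1) ((slot J 1 * slot J 2) (act J dJ - act K dK)) := by
  refine tensor_ext fun X Y Z ↦ ?_
  simp [pairSum_apply, slot_one_apply, slot_two_apply, act_three_apply, hN, hJ.cyc, hK.cyc, hI.eq,
    hJ.eq, hK.eq, q.II, q.JJ, q.KK, q.JI, q.JK, q.KJ, q.KI]
  ring

lemma two_nijenhuis_eq' (q : QuaternionRelations I J K) (hI : IsCommutatorTensor s I aI dI)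
    (hJ : IsCommutatorTensor s J aJ dJ) (hK : IsCommutatorTensor s K aK dK)
    {N : (Fin 3 → V) → ℝ} (hN : ∀ X Y Z, N ![X, Y, Z] =
      aI ![Z, I X, Y] - aI ![Y, I X, Z] - aI ![I Y, X, Z] + aI ![I Z, X, Y]) :
    (2 : ℝ) • N = (1 - slot I 0 * slot I 1)
      ((slot K 1 * slot K 2 - slot J 1 * slot J 2) (act J dJ - act K dK)) := by
  refine tensor_ext fun X Y Z ↦ ?_
  simp [slot_zero_apply, slot_one_apply, slot_two_apply, act_three_apply, hN, hJ.cyc, hK.cyc,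
    hI.eq, hJ.eq, hK.eq, q.II, q.JJ, q.KK, q.JI, q.JK, q.KJ, q.KI]
  ring

lemma pairSum_act_add_act_eq (q : QuaternionRelations I J K) (hJ : IsCommutatorTensor s J aJ dJ)
    (hK : IsCommutatorTensor s K aK dK) :
    pairSum I (act J dJ + act K dK) = act J dJ + act K dK := by
  refine tensor_ext fun X Y Z ↦ ?_
  simp only [pairSum_apply]
  simp [act_three_apply, hJ.cyc, hK.cyc, hJ.eq, hK.eq, q.JJ, q.KK, q.JI, q.JK, q.KJ, q.KI]
  ring

end TensorIdentities

/-! ### Contractions -/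

section Contractions

variable {V : Type*} [NormedAddCommGroup V] [InnerProductSpace ℝ V] [FiniteDimensional ℝ V]

omit [FiniteDimensional ℝ V] in
lemma isLinearMap_sum_smul {ι : Type*} [Fintype ι] {f : V → ℝ} (hf : IsLinearMap ℝ f) (c : ι → ℝ)
    (v : ι → V) : f (∑ i, c i • v i) = ∑ i, c i * f (v i) :=
  (map_sum (hf.mk' f) _ _).trans (Finset.sum_congr rfl fun i _ ↦ hf.map_smul (c i) (v i))

/-- A skew-symmetric endomorphism can be moved to the other argument of a contraction. -/
lemma sum_skew_transfer {A : V →L[ℝ] V} (hA : ∀ v w, (inner ℝ (A v) w : ℝ) = - inner ℝ v (A w))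
    {b : V → V → ℝ} (hl : ∀ w, IsLinearMap ℝ (fun v ↦ b v w)) (hr : ∀ v, IsLinearMap ℝ (b v)) :
    ∑ j, b (A (stdOrthonormalBasis ℝ V j)) (stdOrthonormalBasis ℝ V j) =
      - ∑ j, b (stdOrthonormalBasis ℝ V j) (A (stdOrthonormalBasis ℝ V j)) := by
  set e := stdOrthonormalBasis ℝ V
  have h1 : ∀ j, b (A (e j)) (e j) = ∑ i, (inner ℝ (e i) (A (e j)) : ℝ) * b (e i) (e j) := by
    intro j
    conv_lhs => rw [← e.sum_repr' (A (e j))]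
    exact isLinearMap_sum_smul (hl (e j)) _ e
  have h2 : ∀ i, b (e i) (A (e i)) = ∑ j, (inner ℝ (e j) (A (e i)) : ℝ) * b (e i) (e j) := by
    intro i
    conv_lhs => rw [← e.sum_repr' (A (e i))]
    exact isLinearMap_sum_smul (hr (e i)) _ e
  simp only [h1, h2]
  rw [Finset.sum_comm, ← Finset.sum_neg_distrib]
  refine Finset.sum_congr rfl fun i _ ↦ ?_
  rw [← Finset.sum_neg_distrib]
  refine Finset.sum_congr rfl fun j _ ↦ ?_
  rw [real_inner_comm, hA]
  ring

lemma formInner_insertFirst {ψ : (Fin 3 → V) → ℝ} {η : (Fin 2 → V) → ℝ} {C : V →L[ℝ] V} (X : V)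
    (hη : ∀ v w, η ![v, w] = inner ℝ v (C w))
    (hψ : ∀ Z, IsLinearMap ℝ (fun Y ↦ ψ ![X, Y, Z])) :
    formInner (insertFirst X ψ) η = (1 / 2) * ∑ j,
      ψ ![X, C (stdOrthonormalBasis ℝ V j), stdOrthonormalBasis ℝ V j] := by
  set e := stdOrthonormalBasis ℝ V with he
  have h1 : ∀ f : Fin 2 → Fin (Module.finrank ℝ V),
      insertFirst X ψ (fun i ↦ e (f i)) * η (fun i ↦ e (f i)) =
        ψ ![X, e (f 0), e (f 1)] * inner ℝ (e (f 0)) (C (e (f 1))) := by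
    intro f
    rw [← hη]
    congr 2 <;> ext i <;> fin_cases i <;> rfl
  have h2 : ∀ j, ψ ![X, C (e j), e j] =
      ∑ i, ψ ![X, e i, e j] * (inner ℝ (e i) (C (e j)) : ℝ) := by
    intro j
    conv_lhs => rw [← e.sum_repr' (C (e j))]
    simpa only [mul_comm] using isLinearMap_sum_smul (hψ (e j)) _ e
  rw [formInner, ← he, Finset.sum_congr rfl (fun f _ ↦ h1 f), Finset.sum_congr rfl (fun j _ ↦ h2 j),
    Finset.sum_comm, ← Fintype.sum_prod_type', ← (finTwoArrowEquiv _).sum_comp]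
  simp

variable (s : V →ₗ[ℝ] V →ₗ[ℝ] V →ₗ[ℝ] ℝ) {I J K A B : V →L[ℝ] V}
  {a d aI aJ aK dI dJ dK : (Fin 3 → V) → ℝ} {η ωI ωK : (Fin 2 → V) → ℝ}

/-- The contraction `∑ t(X, e, r e)` over an orthonormal basis, for
`t(X, Y, Z) = s(X, Y, Z) - s(X, Z, Y)`. -/
noncomputable def traceLast (r : V →L[ℝ] V) (X : V) : ℝ :=
  ∑ j, (s X (stdOrthonormalBasis ℝ V j) (r (stdOrthonormalBasis ℝ V j))
    - s X (r (stdOrthonormalBasis ℝ V j)) (stdOrthonormalBasis ℝ V j))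

/-- The contraction `∑ t(e, X, r e)` over an orthonormal basis, for
`t(X, Y, Z) = s(X, Y, Z) - s(X, Z, Y)`. -/
noncomputable def traceOuter (r : V →L[ℝ] V) (X : V) : ℝ :=
  ∑ j, (s (stdOrthonormalBasis ℝ V j) X (r (stdOrthonormalBasis ℝ V j))
    - s (stdOrthonormalBasis ℝ V j) (r (stdOrthonormalBasis ℝ V j)) X)

lemma traceLast_neg (r : V →L[ℝ] V) (X : V) : traceLast s (-r) X = - traceLast s r X := by
  simp only [traceLast, ← Finset.sum_neg_distrib]
  exact Finset.sum_congr rfl fun j _ ↦ by simp; ring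

lemma traceOuter_neg (r : V →L[ℝ] V) (X : V) : traceOuter s (-r) X = - traceOuter s r X := by
  simp only [traceOuter, ← Finset.sum_neg_distrib]
  exact Finset.sum_congr rfl fun j _ ↦ by simp; ring

lemma traceOuter_apply_neg (r : V →L[ℝ] V) (X : V) :
    traceOuter s r (-X) = - traceOuter s r X := by
  simp only [traceOuter, ← Finset.sum_neg_distrib]
  exact Finset.sum_congr rfl fun j _ ↦ by simp; ring

variable {s}

lemma sum_nabla_contract (hA : ∀ v w, (inner ℝ (A v) w : ℝ) = - inner ℝ v (A w))
    (hB : IsCommutatorTensor s B a d) {r : V →L[ℝ] V} (hr : ∀ v, B (A v) = r v) (X : V) :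
    ∑ j, a ![X, A (stdOrthonormalBasis ℝ V j), stdOrthonormalBasis ℝ V j] =
      - 2 * traceLast s r X := by
  have h := sum_skew_transfer hA (b := fun y z ↦ s X y (B z) - s X (B z) y)
    (fun w ↦ ⟨fun _ _ ↦ by simp; ring, fun _ _ ↦ by simp; ring⟩)
    (fun w ↦ ⟨fun _ _ ↦ by simp; ring, fun _ _ ↦ by simp; ring⟩)
  simp only [hr] at h
  have h' : ∀ j, a ![X, A (stdOrthonormalBasis ℝ V j), stdOrthonormalBasis ℝ V j] =
      (s X (A (stdOrthonormalBasis ℝ V j)) (B (stdOrthonormalBasis ℝ V j))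
        - s X (B (stdOrthonormalBasis ℝ V j)) (A (stdOrthonormalBasis ℝ V j)))
      - (s X (stdOrthonormalBasis ℝ V j) (r (stdOrthonormalBasis ℝ V j))
        - s X (r (stdOrthonormalBasis ℝ V j)) (stdOrthonormalBasis ℝ V j)) := by
    intro j; rw [hB.eq, hr]; ring
  rw [Finset.sum_congr rfl fun j _ ↦ h' j, Finset.sum_sub_distrib, h, traceLast]
  ring

/-- The contraction of `dω_B` with `ω_A`, in terms of the traces of `t` along `B ∘ A` and `A`. -/
lemma contract_eq (hA : ∀ v w, (inner ℝ (A v) w : ℝ) = - inner ℝ v (A w))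
    (hη : ∀ v w, η ![v, w] = inner ℝ v (A w))
    (hB : IsCommutatorTensor s B a d) {r : V →L[ℝ] V} (hr : ∀ v, B (A v) = r v)
    (X : Fin 1 → V) :
    contract η d X = - traceLast s r (X 0) + traceOuter s r (X 0) + traceOuter s A (B (X 0)) := by
  rw [contract, formInner_insertFirst (X 0) hη fun Z ↦
    ⟨fun _ _ ↦ by simp [hB.cyc, hB.eq]; ring, fun _ _ ↦ by simp [hB.cyc, hB.eq]; ring⟩]
  set Y := X 0
  have h := sum_skew_transfer hA
    (b := fun y z ↦ s y z (B Y) - s y (B Y) z + s y (B z) Y - s y Y (B z))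
    (fun w ↦ ⟨fun _ _ ↦ by simp; ring, fun _ _ ↦ by simp; ring⟩)
    (fun w ↦ ⟨fun _ _ ↦ by simp; ring, fun _ _ ↦ by simp; ring⟩)
  simp only [hr] at h
  have h1 : ∑ j, a ![A (stdOrthonormalBasis ℝ V j), stdOrthonormalBasis ℝ V j, Y] =
      traceOuter s r Y + traceOuter s A (B Y) := by
    simp only [hB.eq]
    rw [h, traceOuter, traceOuter, ← Finset.sum_add_distrib, ← Finset.sum_neg_distrib]
    exact Finset.sum_congr rfl fun j _ ↦ by ring
  have h2 : ∑ j, a ![stdOrthonormalBasis ℝ V j, Y, A (stdOrthonormalBasis ℝ V j)] =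
      traceOuter s r Y + traceOuter s A (B Y) := by
    simp only [hB.eq, hr]
    rw [traceOuter, traceOuter, ← Finset.sum_add_distrib]
    exact Finset.sum_congr rfl fun j _ ↦ by ring
  simp only [hB.cyc, Finset.sum_add_distrib, sum_nabla_contract hA hB hr, h1, h2]
  ring

lemma act_lambda_eq (q : QuaternionRelations I J K)
    (hIs : ∀ v w, (inner ℝ (I v) w : ℝ) = - inner ℝ v (I w))
    (hKs : ∀ v w, (inner ℝ (K v) w : ℝ) = - inner ℝ v (K w))
    (hωI : ∀ v w, ωI ![v, w] = inner ℝ v (I w)) (hωK : ∀ v w, ωK ![v, w] = inner ℝ v (K w))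
    (hI : IsCommutatorTensor s I aI dI) (hJ : IsCommutatorTensor s J aJ dJ)
    (hK : IsCommutatorTensor s K aK dK) :
    act I (fun X : Fin 1 → V ↦ formInner (insertFirst (X 0) aJ) ωK) =
        act I (contract ωK dJ) + act J (contract ωK dI) + act J (contract ωI dK) ∧
      act I (fun X : Fin 1 → V ↦ formInner (insertFirst (X 0) aJ) ωK) =
        act I (contract ωK dJ) + contract ωI dI - contract ωK dK := by
  have hlam : ∀ X, formInner (insertFirst X aJ) ωK = - traceLast s I X := by
    intro X
    rw [formInner_insertFirst X hωK fun Z ↦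
      ⟨fun _ _ ↦ by simp [hJ.eq]; ring, fun _ _ ↦ by simp [hJ.eq]; ring⟩,
      sum_nabla_contract hKs hJ q.JK]
    ring
  have hKJ := contract_eq hKs hωK hJ q.JK
  have hKI := contract_eq hKs hωK hI (r := -J) (by simp [q.IK])
  have hIK := contract_eq hIs hωI hK q.KI
  have hII := contract_eq hIs hωI hI (r := -ContinuousLinearMap.id ℝ V) (by simp [q.II])
  have hKK := contract_eq hKs hωK hK (r := -ContinuousLinearMap.id ℝ V) (by simp [q.KK])
  constructor
  · ext X
    simp only [act_one_apply, hlam, hKJ, hKI, hIK, Pi.add_apply, traceLast_neg, traceOuter_neg,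
      q.JI, q.IJ, q.KJ, traceOuter_apply_neg]
    ring
  · ext X
    simp only [act_one_apply, hlam, hKJ, hII, hKK, Pi.add_apply, Pi.sub_apply, traceLast_neg,
      traceOuter_neg, q.JI, traceOuter_apply_neg]
    ring

end Contractions

/-! ### The connection one-form of an adapted basis -/

section ConnectionForm

variable {V : Type*} [NormedAddCommGroup V] [InnerProductSpace ℝ V]

/-- The relations between the covariant derivatives `D_A : Z ↦ (X ↦ (∇_X A) Z)` of the members
`A = I, J, K` of an adapted basis that come from differentiating the products `A ∘ B`. -/
structure ProductRules (I J K : V →L[ℝ] V) (DI DJ DK : V →L[ℝ] V →L[ℝ] V) : Prop where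
  II : ∀ Z X, DI (I Z) X = - I (DI Z X)
  JJ : ∀ Z X, DJ (J Z) X = - J (DJ Z X)
  KK : ∀ Z X, DK (K Z) X = - K (DK Z X)
  IJ : ∀ Z X, DI (J Z) X = DK Z X - I (DJ Z X)
  JK : ∀ Z X, DJ (K Z) X = DI Z X - J (DK Z X)
  KI : ∀ Z X, DK (I Z) X = DJ Z X - K (DI Z X)
  JI : ∀ Z X, DJ (I Z) X = - DK Z X - J (DI Z X)
  KJ : ∀ Z X, DK (J Z) X = - DI Z X - K (DJ Z X)
  IK : ∀ Z X, DI (K Z) X = - DJ Z X - I (DK Z X)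

variable {I J K : V →L[ℝ] V} {DI DJ DK : V →L[ℝ] V →L[ℝ] V}

lemma ProductRules.rotate (h : ProductRules I J K DI DJ DK) : ProductRules J K I DJ DK DI :=
  ⟨h.JJ, h.KK, h.II, h.JK, h.KI, h.IJ, h.KJ, h.IK, h.JI⟩

/-- The endomorphism `4 θ_X = I ∇_X I + J ∇_X J + K ∇_X K` satisfies `[θ_X, I] = ∇_X I`. -/
lemma ProductRules.commutator (q : QuaternionRelations I J K)
    (h : ProductRules I J K DI DJ DK) (X Z : V) :
    (I (DI (I Z) X) + J (DJ (I Z) X) + K (DK (I Z) X))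
      - I (I (DI Z X) + J (DJ Z X) + K (DK Z X)) = (4 : ℝ) • DI Z X := by
  simp only [h.II, h.JI, h.KI, map_add, map_neg, map_sub, q.II, q.JJ, q.KK, q.IJ, q.IK]
  module

variable (I J K DI DJ DK) in
/-- The trilinear form `s(X, Y, Z) = ⟨Y, θ_X Z⟩ / 2` with
`4 θ_X = I ∇_X I + J ∇_X J + K ∇_X K`. -/
noncomputable def potential : V →ₗ[ℝ] V →ₗ[ℝ] V →ₗ[ℝ] ℝ :=
  LinearMap.mk₂ ℝ (fun X Y ↦
    { toFun := fun Z ↦ (1 / 8) * inner ℝ Y (I (DI Z X) + J (DJ Z X) + K (DK Z X))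
      map_add' := fun _ _ ↦ by simp [inner_add_right]; ring
      map_smul' := fun _ _ ↦ by simp [inner_add_right, inner_smul_right]; ring })
    (fun _ _ _ ↦ by ext; simp [inner_add_right]; ring)
    (fun _ _ _ ↦ by ext; simp [inner_add_right, inner_smul_right]; ring)
    (fun _ _ _ ↦ by ext; simp [inner_add_right, inner_add_left]; ring)
    (fun _ _ _ ↦ by ext; simp [inner_add_right, inner_smul_left]; ring)

lemma potential_apply (X Y Z : V) : potential I J K DI DJ DK X Y Z =
    (1 / 8) * inner ℝ Y (I (DI Z X) + J (DJ Z X) + K (DK Z X)) := rfl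

lemma potential_rotate : potential J K I DJ DK DI = potential I J K DI DJ DK := by
  ext X Y Z
  rw [potential_apply, potential_apply]
  congr 2
  abel

/-- The covariant derivative of `ω_I` is the commutator tensor of the potential: the form `θ` is
skew-symmetric and `∇_X I = [θ_X, I]`. -/
lemma isCommutatorTensor_of_productRules (q : QuaternionRelations I J K)
    (h : ProductRules I J K DI DJ DK)
    (hI : ∀ v w, (inner ℝ (I v) w : ℝ) = - inner ℝ v (I w))
    (hJ : ∀ v w, (inner ℝ (J v) w : ℝ) = - inner ℝ v (J w))
    (hK : ∀ v w, (inner ℝ (K v) w : ℝ) = - inner ℝ v (K w))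
    (sI : ∀ X Y Z, (inner ℝ Y (DI Z X) : ℝ) = - inner ℝ Z (DI Y X))
    (sJ : ∀ X Y Z, (inner ℝ Y (DJ Z X) : ℝ) = - inner ℝ Z (DJ Y X))
    (sK : ∀ X Y Z, (inner ℝ Y (DK Z X) : ℝ) = - inner ℝ Z (DK Y X))
    {a d : (Fin 3 → V) → ℝ} (ha : ∀ X Y Z, a ![X, Y, Z] = inner ℝ Y (DI Z X))
    (hd : ∀ X Y Z, d ![X, Y, Z] = a ![X, Y, Z] + a ![Y, Z, X] + a ![Z, X, Y]) :
    IsCommutatorTensor (potential I J K DI DJ DK) I a d := by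
  refine ⟨fun X Y Z ↦ ?_, hd⟩
  have skew : ∀ Y Z, potential I J K DI DJ DK X Y Z = - potential I J K DI DJ DK X Z Y := by
    -- each `A ∘ D_A` is skew, since `A` and `D_A` are skew and anticommute
    have key : ∀ {A : V →L[ℝ] V} {D : V →L[ℝ] V →L[ℝ] V},
        (∀ v w, (inner ℝ (A v) w : ℝ) = - inner ℝ v (A w)) →
        (∀ X Y Z, (inner ℝ Y (D Z X) : ℝ) = - inner ℝ Z (D Y X)) →
        (∀ Z X, D (A Z) X = - A (D Z X)) →
        ∀ Y Z, (inner ℝ Y (A (D Z X)) : ℝ) = - inner ℝ Z (A (D Y X)) := by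
      intro A D hA hD hAD Y Z
      have h1 := hA Y (D Z X)
      have h2 := hD X (A Y) Z
      rw [hAD, inner_neg_right] at h2
      linarith
    intro Y Z
    simp only [potential_apply, inner_add_right, key hI sI h.II Y Z, key hJ sJ h.JJ Y Z,
      key hK sK h.KK Y Z]
    ring
  have hc := congrArg (fun v ↦ (inner ℝ Y v : ℝ)) (h.commutator q X Z)
  simp only [inner_sub_right, inner_smul_right] at hc
  rw [ha, skew (I Z) Y, skew Z (I Y)]
  simp only [potential_apply]
  have h3 := hI Y (I (DI Z X) + J (DJ Z X) + K (DK Z X))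
  linarith

end ConnectionForm

/-! ### The covariant derivative of a field of endomorphisms -/

section CovariantDerivativeOfEndomorphism

lemma continuousAlternatingMap_two_swap {V : Type*} [AddCommGroup V] [Module ℝ V]
    [TopologicalSpace V] (η : V [⋀^Fin 2]→L[ℝ] ℝ) (a b : V) : η ![a, b] = - η ![b, a] := by
  have := η.toAlternatingMap.map_swap ![b, a] (i := 0) (j := 1) (by decide)
  rw [show (![b, a] ∘ Equiv.swap (0 : Fin 2) 1) = ![a, b] by
    ext i; fin_cases i <;> rfl] at this
  exact this

variable {E : Type*} [NormedAddCommGroup E] [NormedSpace ℝ E] [FiniteDimensional ℝ E]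
  {M : Type*} [TopologicalSpace M] [ChartedSpace E M] [IsManifold 𝓘(ℝ, E) ∞ M]

/-- The field `A` of endomorphisms maps vector fields differentiable at `x` to vector fields
differentiable at `x`. -/
def PreservesMDiffAt (A : Π x : M, TangentSpace 𝓘(ℝ, E) x →L[ℝ] TangentSpace 𝓘(ℝ, E) x)
    (x : M) : Prop :=
  ∀ Z : Π x : M, TangentSpace 𝓘(ℝ, E) x, MDiffAt (T% Z) x → MDiffAt (T% (fun y ↦ A y (Z y))) x

variable [RiemannianBundle (fun x : M ↦ TangentSpace 𝓘(ℝ, E) x)]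
  [IsContMDiffRiemannianBundle 𝓘(ℝ, E) ∞ E (fun x : M ↦ TangentSpace 𝓘(ℝ, E) x)]
  {A B C : Π x : M, TangentSpace 𝓘(ℝ, E) x →L[ℝ] TangentSpace 𝓘(ℝ, E) x}
  {X Y Z : Π x : M, TangentSpace 𝓘(ℝ, E) x} {x : M}

lemma tensorialAt_covariantDerivative (hA : PreservesMDiffAt A x) :
    TensorialAt 𝓘(ℝ, E) E (fun Z : Π x : M, TangentSpace 𝓘(ℝ, E) x ↦
      leviCivita (fun y ↦ A y (Z y)) x - A x ∘L leviCivita Z x) x where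
  smul {f σ} hf hσ := by
    have h : (fun y ↦ A y ((f • σ) y)) = f • fun y ↦ A y (σ y) := by ext y; simp
    rw [h, leviCivita.isCovariantDerivativeOn.leibniz (hA σ hσ) hf,
      leviCivita.isCovariantDerivativeOn.leibniz hσ hf]
    ext v
    simp [smul_sub]
  add {σ σ'} hσ hσ' := by
    have h : (fun y ↦ A y ((σ + σ') y)) = (fun y ↦ A y (σ y)) + fun y ↦ A y (σ' y) := by
      ext y; simp
    rw [h, leviCivita.isCovariantDerivativeOn.add (hA σ hσ) (hA σ' hσ'),
      leviCivita.isCovariantDerivativeOn.add hσ hσ']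
    ext v
    simp
    abel

open Classical in
/-- The covariant derivative `Z ↦ (X ↦ (∇_X A) Z)` at `x` of a field `A` of endomorphisms, with
respect to the Levi-Civita connection. The value is `0` if `A` does not preserve differentiability
of vector fields at `x`. -/
noncomputable def covDerivEnd
    (A : Π x : M, TangentSpace 𝓘(ℝ, E) x →L[ℝ] TangentSpace 𝓘(ℝ, E) x) (x : M) :
    TangentSpace 𝓘(ℝ, E) x →L[ℝ] TangentSpace 𝓘(ℝ, E) x →L[ℝ] TangentSpace 𝓘(ℝ, E) x :=
  if hA : PreservesMDiffAt A x then TensorialAt.mkHom _ x (tensorialAt_covariantDerivative hA)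
  else 0

lemma covDerivEnd_apply (hA : PreservesMDiffAt A x) (hZ : MDiffAt (T% Z) x)
    (v : TangentSpace 𝓘(ℝ, E) x) :
    covDerivEnd A x (Z x) v = leviCivita (fun y ↦ A y (Z y)) x v - A x (leviCivita Z x v) := by
  rw [covDerivEnd, dif_pos hA, TensorialAt.mkHom_apply _ hZ]
  rfl

lemma leviCivita_congr (hY : MDiffAt (T% Y) x) (hZ : MDiffAt (T% Z) x)
    (h : ∀ᶠ y in nhds x, Y y = Z y) : leviCivita Y x = leviCivita Z x :=
  leviCivita.isCovariantDerivativeOn.congr_of_eventuallyEq hY hZ Filter.univ_mem h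

lemma leviCivita_neg (hZ : MDiffAt (T% Z) x) :
    leviCivita (fun y ↦ - Z y) x = - leviCivita Z x := by
  have := leviCivita.isCovariantDerivativeOn.smul_const (x := x) (-1 : ℝ) hZ
  have h : (fun y ↦ - Z y) = (-1 : ℝ) • Z := by ext y; simp
  rw [h, this]
  simp

/-- The product rule `(∇_w A) (B v) + A ((∇_w B) v) = (∇_w (A B)) v`, for `C = A B` near `x`. -/
lemma covDerivEnd_comp (hA : PreservesMDiffAt A x) (hB : PreservesMDiffAt B x)
    (hC : PreservesMDiffAt C x) (h : ∀ᶠ y in nhds x, ∀ v, A y (B y v) = C y v)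
    (v w : TangentSpace 𝓘(ℝ, E) x) :
    covDerivEnd A x (B x v) w = covDerivEnd C x v w - A x (covDerivEnd B x v w) := by
  have hv : MDiffAt (T% (FiberBundle.extend E v)) x := FiberBundle.mdifferentiableAt_extend ..
  have h1 := covDerivEnd_apply hA (hB _ hv) w
  have h2 := covDerivEnd_apply hB hv w
  have h3 := covDerivEnd_apply hC hv w
  rw [FiberBundle.extend_apply_self] at h1 h2 h3
  have h4 := leviCivita_congr (hA _ (hB _ hv)) (hC _ hv) (h.mono fun y hy ↦ hy _)
  rw [h1, h2, h3, h4, map_sub, ← h.self_of_nhds]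
  abel

lemma covDerivEnd_comp_neg (hA : PreservesMDiffAt A x) (hB : PreservesMDiffAt B x)
    (hC : PreservesMDiffAt C x) (h : ∀ᶠ y in nhds x, ∀ v, A y (B y v) = - C y v)
    (v w : TangentSpace 𝓘(ℝ, E) x) :
    covDerivEnd A x (B x v) w = - covDerivEnd C x v w - A x (covDerivEnd B x v w) := by
  have hv : MDiffAt (T% (FiberBundle.extend E v)) x := FiberBundle.mdifferentiableAt_extend ..
  have h1 := covDerivEnd_apply hA (hB _ hv) w
  have h2 := covDerivEnd_apply hB hv w
  have h3 := covDerivEnd_apply hC hv w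
  rw [FiberBundle.extend_apply_self] at h1 h2 h3
  have h5 : MDiffAt (T% (fun y ↦ - C y (FiberBundle.extend E v y))) x :=
    mdifferentiableAt_neg_section (hC _ hv)
  have h4 := leviCivita_congr (hA _ (hB _ hv)) h5 (h.mono fun y hy ↦ hy _)
  rw [h1, h2, h3, h4, map_sub, ← neg_eq_iff_eq_neg.mpr (h.self_of_nhds _),
    leviCivita_neg (hC _ hv)]
  simp
  abel

/-- The covariant derivative of a field of endomorphisms with square `-1` anticommutes with it. -/
lemma covDerivEnd_of_sq_eq_neg_one (hA : PreservesMDiffAt A x)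
    (h : ∀ᶠ y in nhds x, ∀ v, A y (A y v) = - v) (v w : TangentSpace 𝓘(ℝ, E) x) :
    covDerivEnd A x (A x v) w = - A x (covDerivEnd A x v w) := by
  have hid : PreservesMDiffAt (fun y ↦ ContinuousLinearMap.id ℝ (TangentSpace 𝓘(ℝ, E) y)) x :=
    fun Z hZ ↦ hZ
  have hv : MDiffAt (T% (FiberBundle.extend E v)) x := FiberBundle.mdifferentiableAt_extend ..
  have h0 := covDerivEnd_apply hid hv w
  rw [FiberBundle.extend_apply_self] at h0
  have := covDerivEnd_comp_neg hA hA hid (by simpa using h) v w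
  rw [this, h0]
  simp

/-- The skew-symmetry of an orthogonal complex structure. -/
lemma inner_skew {V : Type*} [NormedAddCommGroup V] [InnerProductSpace ℝ V] {A : V →L[ℝ] V}
    (h2 : ∀ v, A (A v) = -v) (ho : ∀ v w, (inner ℝ (A v) (A w) : ℝ) = inner ℝ v w) (v w : V) :
    (inner ℝ (A v) w : ℝ) = - inner ℝ v (A w) := by
  rw [← ho v (A w), h2, inner_neg_right, neg_neg]

/-- The covariant derivative of the Kähler form is given by the covariant derivative of the
complex structure. -/
lemma nablaForm_kahlerForm (hA : PreservesMDiffAt A x)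
    (h2 : ∀ᶠ y in nhds x, ∀ v, A y (A y v) = - v)
    (ho : ∀ᶠ y in nhds x, ∀ v w, (inner ℝ (A y v) (A y w) : ℝ) = inner ℝ v w)
    (u v w : TangentSpace 𝓘(ℝ, E) x) :
    nablaForm (kahlerForm A) x ![u, v, w] = inner ℝ v (covDerivEnd A x w u) := by
  let ext : TangentSpace 𝓘(ℝ, E) x → Π y : M, TangentSpace 𝓘(ℝ, E) y :=
    fun v ↦ FiberBundle.extend E v
  have hext : ∀ v, MDiffAt (T% (ext v)) x := fun v ↦ FiberBundle.mdifferentiableAt_extend ..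
  have hext_self : ∀ v, ext v x = v := fun v ↦ FiberBundle.extend_apply_self E v
  have hk := kahlerForm_apply (A := A) h2.self_of_nhds ho.self_of_nhds
  have hev : (fun y ↦ kahlerForm A y ![ext v y, ext w y]) =ᶠ[nhds x]
      fun y ↦ inner ℝ (ext v y) (A y (ext w y)) := by
    filter_upwards [h2, ho] with y hy hy'
    exact kahlerForm_apply hy hy' _ _
  have hm := leviCivita_metric (hext u) (hext v) (hA _ (hext w))
  have hc := covDerivEnd_apply hA (hext w) u
  simp only [hext_self] at hm hc
  have hd : mvfderiv 𝓘(ℝ, E) (fun y ↦ kahlerForm A y ![ext v y, ext w y]) x =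
      mvfderiv 𝓘(ℝ, E) (fun y ↦ inner ℝ (ext v y) (A y (ext w y))) x := by
    rw [mvfderiv, mvfderiv, hev.mfderiv_eq]
    rfl
  change mvfderiv 𝓘(ℝ, E) (fun y ↦ kahlerForm A y ![ext v y, ext w y]) x u
    - kahlerForm A x ![leviCivita (ext v) x u, w]
    - kahlerForm A x ![v, leviCivita (ext w) x u] = _
  rw [hd, hm, hk, hk, hc, inner_sub_right]
  ring

lemma nablaForm_swap (η : Π x : M, TangentSpace 𝓘(ℝ, E) x [⋀^Fin 2]→L[ℝ] ℝ)
    (u v w : TangentSpace 𝓘(ℝ, E) x) :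
    nablaForm η x ![u, v, w] = - nablaForm η x ![u, w, v] := by
  have hs : ∀ y, ∀ a b : TangentSpace 𝓘(ℝ, E) y, η y ![a, b] = - η y ![b, a] :=
    fun y ↦ continuousAlternatingMap_two_swap (η y)
  let ext : TangentSpace 𝓘(ℝ, E) x → Π y : M, TangentSpace 𝓘(ℝ, E) y :=
    fun v ↦ FiberBundle.extend E v
  change mvfderiv 𝓘(ℝ, E) (fun y ↦ η y ![ext v y, ext w y]) x u
    - η x ![leviCivita (ext v) x u, w] - η x ![v, leviCivita (ext w) x u] =
    -(mvfderiv 𝓘(ℝ, E) (fun y ↦ η y ![ext w y, ext v y]) x u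
    - η x ![leviCivita (ext w) x u, v] - η x ![w, leviCivita (ext v) x u])
  rw [show (fun y ↦ η y ![ext v y, ext w y]) = fun y ↦ - η y ![ext w y, ext v y] from
    funext fun y ↦ hs y _ _, mvfderiv_fun_neg, hs x _ w, hs x v]
  simp
  ring

/-- The Nijenhuis tensor in terms of the covariant derivative, since the connection is
torsion-free. -/
lemma nijenhuis₃_eq (hA : PreservesMDiffAt A x)
    (h2 : ∀ v, A x (A x v) = - v)
    (u v w : TangentSpace 𝓘(ℝ, E) x) :
    nijenhuis₃ A x ![u, v, w] = inner ℝ u (A x (covDerivEnd A x w v) - A x (covDerivEnd A x v w)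
      - covDerivEnd A x w (A x v) + covDerivEnd A x v (A x w)) := by
  have hv : MDiffAt (T% (FiberBundle.extend E v)) x := FiberBundle.mdifferentiableAt_extend ..
  have hw : MDiffAt (T% (FiberBundle.extend E w)) x := FiberBundle.mdifferentiableAt_extend ..
  have tor : ∀ {X Y : Π x : M, TangentSpace 𝓘(ℝ, E) x}, MDiffAt (T% X) x → MDiffAt (T% Y) x →
      leviCivita Y x (X x) - leviCivita X x (Y x) = mlieBracket 𝓘(ℝ, E) X Y x :=
    (CovariantDerivative.torsion_eq_zero_iff _).1 leviCivita_torsion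
  have t1 := tor hv hw
  have t2 := tor (hA _ hv) hw
  have t3 := tor hv (hA _ hw)
  have t4 := tor (hA _ hv) (hA _ hw)
  have cv := covDerivEnd_apply hA hv
  have cw := covDerivEnd_apply hA hw
  simp only [FiberBundle.extend_apply_self] at t1 t2 t3 t4 cv cw
  change inner ℝ u (nijenhuis A x v w) = _
  rw [nijenhuis, ← t1, ← t2, ← t3, ← t4, cv, cv, cw, cw]
  simp only [map_sub, h2]
  congr 1
  abel

end CovariantDerivativeOfEndomorphism

/-! ### The exterior derivative and the Levi-Civita connection -/

section ExteriorDerivative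

lemma differentiableAt_continuousAlternatingMap {E : Type*} [NormedAddCommGroup E]
    [NormedSpace ℝ E] [FiniteDimensional ℝ E] {k : ℕ} {f : E → E [⋀^Fin k]→L[ℝ] ℝ} {y : E}
    (h : ∀ v, DifferentiableAt ℝ (fun z ↦ f z v) y) : DifferentiableAt ℝ f y := by
  -- the values on tuples of basis vectors determine a form, and linear maps from the
  -- finite-dimensional space of such families of values are continuous
  let b := Module.finBasis ℝ E
  let ev : (E [⋀^Fin k]→L[ℝ] ℝ) →ₗ[ℝ] ((Fin k → Fin (Module.finrank ℝ E)) → ℝ) :=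
    { toFun := fun g i ↦ g (fun j ↦ b (i j))
      map_add' := fun _ _ ↦ rfl
      map_smul' := fun _ _ ↦ rfl }
  have hinj : LinearMap.ker ev = ⊥ := by
    refine LinearMap.ker_eq_bot.2 fun g₁ g₂ hg ↦ ?_
    refine ContinuousAlternatingMap.toAlternatingMap_injective ?_
    refine AlternatingMap.coe_multilinearMap_injective ?_
    exact Module.Basis.ext_multilinear (fun _ ↦ b) fun i ↦ congrFun hg i
  obtain ⟨l, hl⟩ := ev.exists_leftInverse_of_injective hinj
  have hf : f = fun z ↦ LinearMap.toContinuousLinearMap l (ev (f z)) := by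
    ext1 z
    exact (LinearMap.congr_fun hl (f z)).symm
  rw [hf]
  exact (LinearMap.toContinuousLinearMap l).differentiableAt.comp y
    (differentiableAt_pi.2 fun i ↦ h _)

variable {E : Type*} [NormedAddCommGroup E] [NormedSpace ℝ E] [FiniteDimensional ℝ E]
  {M : Type*} [TopologicalSpace M] [ChartedSpace E M] [IsManifold 𝓘(ℝ, E) ∞ M]

omit [FiniteDimensional ℝ E] in
lemma mfderiv_extChartAt_self (x : M) (v : TangentSpace 𝓘(ℝ, E) x) :
    mfderiv 𝓘(ℝ, E) 𝓘(ℝ, E) (extChartAt 𝓘(ℝ, E) x) x v = v := by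
  rw [(mdifferentiableAt_extChartAt (mem_chart_source E x)).mfderiv]
  have := fderivWithin_extChartAt_comp_extChartAt_symm_range (I := 𝓘(ℝ, E)) (x := x)
  exact congrArg (fun f : E →L[ℝ] E ↦ f v) this

omit [FiniteDimensional ℝ E] in
/-- Near `x`, the extension of a tangent vector at `x` is constant in the chart at `x`. -/
lemma mfderiv_extChartAt_symm_eq_extend (x : M) (v : TangentSpace 𝓘(ℝ, E) x) {y : E}
    (hy : y ∈ (extChartAt 𝓘(ℝ, E) x).target) :
    mfderiv 𝓘(ℝ, E) 𝓘(ℝ, E) (extChartAt 𝓘(ℝ, E) x).symm y v =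
      FiberBundle.extend E v ((extChartAt 𝓘(ℝ, E) x).symm y) := by
  have hsrc : (extChartAt 𝓘(ℝ, E) x).symm y ∈ (chartAt E x).source := by
    simpa using (extChartAt 𝓘(ℝ, E) x).map_target hy
  have h1 := TangentBundle.symmL_trivializationAt (I := 𝓘(ℝ, E)) hsrc
  rw [(extChartAt 𝓘(ℝ, E) x).right_inv hy, modelWithCornersSelf_coe, Set.range_id,
    mfderivWithin_univ] at h1
  have h2 := TangentBundle.continuousLinearMapAt_trivializationAt (I := 𝓘(ℝ, E))
    (mem_chart_source E x)
  have h3 : (trivializationAt E (TangentSpace 𝓘(ℝ, E)) x ⟨x, v⟩).2 = v := by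
    have h4 := (trivializationAt E (TangentSpace 𝓘(ℝ, E)) x).coe_linearMapAt_of_mem (R := ℝ)
      (FiberBundle.mem_baseSet_trivializationAt' x)
    have h5 := congrFun h4 v
    rw [← h5]
    refine Eq.trans ?_ (mfderiv_extChartAt_self x v)
    rw [← h2]
    rfl
  rw [FiberBundle.extend, h3]
  exact (DFunLike.congr_fun h1 v).symm.trans 
    ((trivializationAt E (TangentSpace 𝓘(ℝ, E)) x).symmL_apply (R := ℝ) hsrc v)

omit [FiniteDimensional ℝ E] in
/-- Vector fields that are constant in a chart commute. -/
lemma mlieBracket_extend (x : M) (v w : TangentSpace 𝓘(ℝ, E) x) :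
    mlieBracket 𝓘(ℝ, E) (FiberBundle.extend E v) (FiberBundle.extend E w) x = 0 := by
  have hpull : ∀ u : TangentSpace 𝓘(ℝ, E) x,
      mpullbackWithin 𝓘(ℝ, E) 𝓘(ℝ, E) (extChartAt 𝓘(ℝ, E) x).symm (FiberBundle.extend E u)
        (Set.range 𝓘(ℝ, E)) =ᶠ[nhds (extChartAt 𝓘(ℝ, E) x x)] fun _ ↦ u := by
    intro u
    filter_upwards [extChartAt_target_mem_nhds (I := 𝓘(ℝ, E)) x] with y hy
    refine ((isInvertible_mfderivWithin_extChartAt_symm hy).inverse_apply_eq).2 ?_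
    rw [modelWithCornersSelf_coe, Set.range_id, mfderivWithin_univ]
    exact (mfderiv_extChartAt_symm_eq_extend x u hy).symm
  have hconst : ∀ (a b : E) (V W : E → E), (V =ᶠ[nhds (extChartAt 𝓘(ℝ, E) x x)] fun _ ↦ a) →
      (W =ᶠ[nhds (extChartAt 𝓘(ℝ, E) x x)] fun _ ↦ b) →
      lieBracketWithin ℝ V W Set.univ (extChartAt 𝓘(ℝ, E) x x) = 0 := by
    intro a b V W hV hW
    rw [lieBracketWithin_univ, Filter.EventuallyEq.lieBracket_vectorField_eq hV hW]
    simp [lieBracket]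
  rw [← mlieBracketWithin_univ, mlieBracketWithin_apply]
  rw [modelWithCornersSelf_coe, Set.range_id] at hpull ⊢
  simp only [Set.preimage_univ, Set.univ_inter]
  exact (congrArg _ (hconst _ _ _ _ (hpull v) (hpull w))).trans (map_zero _)

variable [RiemannianBundle (fun x : M ↦ TangentSpace 𝓘(ℝ, E) x)]
  [IsContMDiffRiemannianBundle 𝓘(ℝ, E) ∞ E (fun x : M ↦ TangentSpace 𝓘(ℝ, E) x)]

lemma leviCivita_extend_comm (x : M) (v w : TangentSpace 𝓘(ℝ, E) x) :
    leviCivita (FiberBundle.extend E v) x w = leviCivita (FiberBundle.extend E w) x v := by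
  have hv : MDiffAt (T% (FiberBundle.extend E v)) x := FiberBundle.mdifferentiableAt_extend ..
  have hw : MDiffAt (T% (FiberBundle.extend E w)) x := FiberBundle.mdifferentiableAt_extend ..
  have h := (CovariantDerivative.torsion_eq_zero_iff _).1
    (leviCivita_torsion (E := E) (M := M)) hw hv
  rw [mlieBracket_extend, FiberBundle.extend_apply_self, FiberBundle.extend_apply_self] at h
  exact sub_eq_zero.1 h

/-- The exterior derivative of a two-form is the cyclic sum of its covariant derivative. In the
chart-constant extensions of the three vectors all Lie brackets vanish, and the terms with covariant
derivatives of vector fields cancel in pairs. -/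
lemma extDer_eq_cyclic_nablaForm {η : Π x : M, TangentSpace 𝓘(ℝ, E) x [⋀^Fin 2]→L[ℝ] ℝ} {x : M}
    (hη : ∀ Y Z : Π x : M, TangentSpace 𝓘(ℝ, E) x, MDiffAt (T% Y) x → MDiffAt (T% Z) x →
      MDifferentiableAt 𝓘(ℝ, E) 𝓘(ℝ, ℝ) (fun y ↦ η y ![Y y, Z y]) x)
    (u v w : TangentSpace 𝓘(ℝ, E) x) :
    extDer η x ![u, v, w] =
      nablaForm η x ![u, v, w] + nablaForm η x ![v, w, u] + nablaForm η x ![w, u, v] := by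
  set φ := extChartAt 𝓘(ℝ, E) x with hφ
  let ext : TangentSpace 𝓘(ℝ, E) x → Π y : M, TangentSpace 𝓘(ℝ, E) y :=
    fun v ↦ FiberBundle.extend E v
  have hext : ∀ v, MDiffAt (T% (ext v)) x := fun v ↦ FiberBundle.mdifferentiableAt_extend ..
  let g : TangentSpace 𝓘(ℝ, E) x → TangentSpace 𝓘(ℝ, E) x → M → ℝ :=
    fun v w y ↦ η y ![ext v y, ext w y]
  have hg : ∀ v w, MDifferentiableAt 𝓘(ℝ, E) 𝓘(ℝ, ℝ) (g v w) x :=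
    fun v w ↦ hη _ _ (hext v) (hext w)
  let θ : E → E [⋀^Fin 2]→L[ℝ] ℝ := fun y ↦
    ((η (φ.symm y)).compContinuousLinearMap (mfderiv 𝓘(ℝ, E) 𝓘(ℝ, E) φ.symm y))
  have hθ : ∀ v w : E, (fun y ↦ θ y ![v, w]) =ᶠ[nhds (φ x)] g v w ∘ φ.symm := by
    intro v w
    filter_upwards [extChartAt_target_mem_nhds (I := 𝓘(ℝ, E)) x] with y hy
    change η (φ.symm y) _ = η (φ.symm y) _
    congr 1
    ext i
    fin_cases i
    · exact mfderiv_extChartAt_symm_eq_extend x v hy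
    · exact mfderiv_extChartAt_symm_eq_extend x w hy
  have hw : ∀ v w, writtenInExtChartAt 𝓘(ℝ, E) 𝓘(ℝ, ℝ) x (g v w) = g v w ∘ φ.symm :=
    fun v w ↦ rfl
  have hgd : ∀ v w, DifferentiableAt ℝ (g v w ∘ φ.symm) (φ x) := by
    intro v w
    have h := ((mdifferentiableAt_iff _ _).1 (hg v w)).2
    rw [hw, modelWithCornersSelf_coe, Set.range_id] at h
    exact differentiableWithinAt_univ.1 h
  have hder : ∀ u v w : TangentSpace 𝓘(ℝ, E) x,
      fderiv ℝ (fun y ↦ θ y ![v, w]) (φ x) u = mvfderiv 𝓘(ℝ, E) (g v w) x u := by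
    intro u v w
    have h := (hg v w).mvfderiv
    rw [hw, modelWithCornersSelf_coe, Set.range_id, fderivWithin_univ] at h
    exact (DFunLike.congr_fun (hθ v w).fderiv_eq u).trans (DFunLike.congr_fun h u).symm
  have hθd : DifferentiableAt ℝ θ (φ x) := by
    refine differentiableAt_continuousAlternatingMap fun v ↦ ?_
    rw [show v = ![v 0, v 1] by ext i; fin_cases i <;> rfl]
    exact (hgd _ _).congr_of_eventuallyEq (hθ _ _)
  have hext_der : extDer η x ![u, v, w] = mvfderiv 𝓘(ℝ, E) (g v w) x u
      - mvfderiv 𝓘(ℝ, E) (g u w) x v + mvfderiv 𝓘(ℝ, E) (g u v) x w := by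
    have h1 : extDer η x ![u, v, w] = extDeriv θ (φ x) ![u, v, w] := by
      change extDeriv θ (φ x) _ = _
      congr 1
      ext i
      fin_cases i <;> exact mfderiv_extChartAt_self x _
    have h2 : ∀ a b c : E, extDeriv θ (φ x) ![a, b, c] = fderiv ℝ (fun y ↦ θ y ![b, c]) (φ x) a
        - fderiv ℝ (fun y ↦ θ y ![a, c]) (φ x) b + fderiv ℝ (fun y ↦ θ y ![a, b]) (φ x) c := by
      intro a b c
      rw [extDeriv_apply hθd, Fin.sum_univ_three,
        show (0 : Fin 3).removeNth ![a, b, c] = ![b, c] by ext i; fin_cases i <;> rfl,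
        show (1 : Fin 3).removeNth ![a, b, c] = ![a, c] by ext i; fin_cases i <;> rfl,
        show (2 : Fin 3).removeNth ![a, b, c] = ![a, b] by ext i; fin_cases i <;> rfl]
      simp
      ring
    rw [h1]
    refine (h2 u v w).trans ?_
    exact congrArg₂ (· + ·) (congrArg₂ (· - ·) (hder u v w) (hder v u w)) (hder w u v)
  have hs : ∀ y, ∀ a b : TangentSpace 𝓘(ℝ, E) y, η y ![a, b] = - η y ![b, a] :=
    fun y ↦ continuousAlternatingMap_two_swap (η y)
  have hnabla : ∀ u v w, nablaForm η x ![u, v, w] = mvfderiv 𝓘(ℝ, E) (g v w) x u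
    - η x ![leviCivita (ext v) x u, w] - η x ![v, leviCivita (ext w) x u] := fun _ _ _ ↦ rfl
  have hgs : mvfderiv 𝓘(ℝ, E) (g w u) x v = - mvfderiv 𝓘(ℝ, E) (g u w) x v := by
    rw [show g w u = fun y ↦ - g u w y from funext fun y ↦ hs y _ _, mvfderiv_fun_neg]
    rfl
  rw [hext_der, hnabla, hnabla, hnabla, hgs, leviCivita_extend_comm x v u,
    leviCivita_extend_comm x w v, leviCivita_extend_comm x w u,
    hs x u, hs x v (leviCivita (ext u) x w), hs x w]
  ring

end ExteriorDerivative

/-! ### Adapted bases -/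

section AdaptedBasis

variable {n : ℕ} {M : Type*} [TopologicalSpace M]
  [ChartedSpace (EuclideanSpace ℝ (Fin (4 * n))) M]
  [IsManifold (𝓡 (4 * n)) ∞ M]

lemma SmoothEndOn.preservesMDiffAt {A : EndField n M} {U : Set M} (hA : SmoothEndOn A U)
    (hU : IsOpen U) {x : M} (hx : x ∈ U) : PreservesMDiffAt A x := fun _ hZ ↦
  ((hA.contMDiffAt (hU.mem_nhds hx)).mdifferentiableAt (by simp)).clm_bundle_apply hZ

variable [RiemannianBundle (fun x : M ↦ TangentSpace (𝓡 (4 * n)) x)]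
  {G : Π x : M, Submodule ℝ (TangentSpace (𝓡 (4 * n)) x →L[ℝ] TangentSpace (𝓡 (4 * n)) x)}
  {U : Set M} {I J K : EndField n M}

lemma IsAdaptedBasis.quaternionRelations (h : IsAdaptedBasis G U I J K) {x : M} (hx : x ∈ U) :
    QuaternionRelations (I x) (J x) (K x) := by
  refine quaternionRelations_of_comp (fun v ↦ ?_) (fun v ↦ ?_) (fun v ↦ ?_) (fun v ↦ ?_)
  · exact DFunLike.congr_fun (h.sq_I x hx) v
  · exact DFunLike.congr_fun (h.sq_J x hx) v
  · exact DFunLike.congr_fun (h.K_eq x hx) v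
  · exact DFunLike.congr_fun (h.anticomm x hx) v

lemma IsAdaptedBasis.rotate (h : IsAdaptedBasis G U I J K) : IsAdaptedBasis G U J K I where
  isOpen := h.isOpen
  smooth A hA := h.smooth A (by
    simp only [Set.mem_insert_iff, Set.mem_singleton_iff] at hA ⊢; tauto)
  span x hx := by
    rw [h.span x hx]
    congr 1
    ext A
    simp only [Set.mem_insert_iff, Set.mem_singleton_iff]
    tauto
  sq_I := h.sq_J
  sq_J x hx := ContinuousLinearMap.ext (h.quaternionRelations hx).KK
  K_eq x hx := ContinuousLinearMap.ext fun v ↦ ((h.quaternionRelations hx).JK v).symm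
  anticomm x hx := ContinuousLinearMap.ext fun v ↦ by
    have := h.quaternionRelations hx
    simp [this.JK, this.KJ]
  orthogonal A hA := h.orthogonal A (by
    simp only [Set.mem_insert_iff, Set.mem_singleton_iff] at hA ⊢; tauto)

lemma IsAdaptedBasis.inner_skew (h : IsAdaptedBasis G U I J K) {x : M} (hx : x ∈ U)
    (v w : TangentSpace (𝓡 (4 * n)) x) : (inner ℝ (I x v) w : ℝ) = - inner ℝ v (I x w) :=
  QuaternionHermitian.inner_skew (h.quaternionRelations hx).II (h.orthogonal I (by simp) x hx) v w

lemma IsAdaptedBasis.kahler_apply (h : IsAdaptedBasis G U I J K) {x : M} (hx : x ∈ U)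
    (v w : TangentSpace (𝓡 (4 * n)) x) : kahler I x ![v, w] = inner ℝ v (I x w) :=
  kahlerForm_apply (h.quaternionRelations hx).II (h.orthogonal I (by simp) x hx) v w

omit [IsManifold (𝓡 (4 * n)) ∞ M] in
lemma exists_alternatingMap_act_add_act (J K : EndField n M) (x : M) :
    ∃ β : TangentSpace (𝓡 (4 * n)) x [⋀^Fin 3]→ₗ[ℝ] ℝ,
      act (J x) (dKahler J x) + act (K x) (dKahler K x) = β := by
  obtain ⟨β, hβ⟩ := exists_alternatingMap_act (J x) (extDer (kahlerForm J) x).toAlternatingMap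
  obtain ⟨γ, hγ⟩ := exists_alternatingMap_act (K x) (extDer (kahlerForm K) x).toAlternatingMap
  exact ⟨β + γ, congrArg₂ (· + ·) hβ hγ⟩

variable [IsContMDiffRiemannianBundle (𝓡 (4 * n)) ∞ (EuclideanSpace ℝ (Fin (4 * n)))
  (fun x : M ↦ TangentSpace (𝓡 (4 * n)) x)] {x : M}

lemma IsAdaptedBasis.productRules (h : IsAdaptedBasis G U I J K) (hx : x ∈ U) :
    ProductRules (I x) (J x) (K x) (covDerivEnd I x) (covDerivEnd J x) (covDerivEnd K x) := by
  have hI := (h.smooth I (by simp)).preservesMDiffAt h.isOpen hx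
  have hJ := (h.smooth J (by simp)).preservesMDiffAt h.isOpen hx
  have hK := (h.smooth K (by simp)).preservesMDiffAt h.isOpen hx
  have q : ∀ᶠ y in nhds x, QuaternionRelations (I y) (J y) (K y) :=
    (h.isOpen.eventually_mem hx).mono fun y hy ↦ h.quaternionRelations hy
  exact
    { II := covDerivEnd_of_sq_eq_neg_one hI (q.mono fun _ hy ↦ hy.II)
      JJ := covDerivEnd_of_sq_eq_neg_one hJ (q.mono fun _ hy ↦ hy.JJ)
      KK := covDerivEnd_of_sq_eq_neg_one hK (q.mono fun _ hy ↦ hy.KK)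
      IJ := covDerivEnd_comp hI hJ hK (q.mono fun _ hy ↦ hy.IJ)
      JK := covDerivEnd_comp hJ hK hI (q.mono fun _ hy ↦ hy.JK)
      KI := covDerivEnd_comp hK hI hJ (q.mono fun _ hy ↦ hy.KI)
      JI := covDerivEnd_comp_neg hJ hI hK (q.mono fun _ hy ↦ hy.JI)
      KJ := covDerivEnd_comp_neg hK hJ hI (q.mono fun _ hy ↦ hy.KJ)
      IK := covDerivEnd_comp_neg hI hK hJ (q.mono fun _ hy ↦ hy.IK) }

lemma IsAdaptedBasis.nablaForm_eq (h : IsAdaptedBasis G U I J K) (hx : x ∈ U)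
    (u v w : TangentSpace (𝓡 (4 * n)) x) :
    nablaForm (kahlerForm I) x ![u, v, w] = inner ℝ v (covDerivEnd I x w u) :=
  nablaForm_kahlerForm ((h.smooth I (by simp)).preservesMDiffAt h.isOpen hx)
    ((h.isOpen.eventually_mem hx).mono fun _ hy ↦ (h.quaternionRelations hy).II)
    ((h.isOpen.eventually_mem hx).mono fun y hy ↦ h.orthogonal I (by simp) y hy) u v w

lemma IsAdaptedBasis.covDerivEnd_skew (h : IsAdaptedBasis G U I J K) (hx : x ∈ U)
    (u v w : TangentSpace (𝓡 (4 * n)) x) :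
    (inner ℝ v (covDerivEnd I x w u) : ℝ) = - inner ℝ w (covDerivEnd I x v u) := by
  rw [← h.nablaForm_eq hx, ← h.nablaForm_eq hx, nablaForm_swap]

lemma IsAdaptedBasis.dKahler_eq (h : IsAdaptedBasis G U I J K) (hx : x ∈ U)
    (u v w : TangentSpace (𝓡 (4 * n)) x) :
    dKahler I x ![u, v, w] = nablaForm (kahlerForm I) x ![u, v, w]
      + nablaForm (kahlerForm I) x ![v, w, u] + nablaForm (kahlerForm I) x ![w, u, v] := by
  refine extDer_eq_cyclic_nablaForm (fun Y Z hY hZ ↦ ?_) u v w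
  have hI := (h.smooth I (by simp)).preservesMDiffAt h.isOpen hx
  refine (mdifferentiableAt_inner hY (hI Z hZ)).congr_of_eventuallyEq ?_
  filter_upwards [h.isOpen.eventually_mem hx] with y hy
  exact h.kahler_apply hy _ _

lemma IsAdaptedBasis.isCommutatorTensor (h : IsAdaptedBasis G U I J K) (hx : x ∈ U) :
    IsCommutatorTensor
      (potential (I x) (J x) (K x) (covDerivEnd I x) (covDerivEnd J x) (covDerivEnd K x))
      (I x) (nablaForm (kahlerForm I) x) (dKahler I x) :=
  isCommutatorTensor_of_productRules (h.quaternionRelations hx) (h.productRules hx)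
    (h.inner_skew hx) (h.rotate.inner_skew hx) (h.rotate.rotate.inner_skew hx)
    (h.covDerivEnd_skew hx) (h.rotate.covDerivEnd_skew hx) (h.rotate.rotate.covDerivEnd_skew hx)
    (h.nablaForm_eq hx) (h.dKahler_eq hx)

lemma IsAdaptedBasis.nijenhuis₃_eq (h : IsAdaptedBasis G U I J K) (hx : x ∈ U)
    (u v w : TangentSpace (𝓡 (4 * n)) x) :
    nijenhuis₃ I x ![u, v, w] = nablaForm (kahlerForm I) x ![w, I x u, v]
      - nablaForm (kahlerForm I) x ![v, I x u, w] - nablaForm (kahlerForm I) x ![I x v, u, w]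
      + nablaForm (kahlerForm I) x ![I x w, u, v] := by
  rw [QuaternionHermitian.nijenhuis₃_eq ((h.smooth I (by simp)).preservesMDiffAt h.isOpen hx)
    (h.quaternionRelations hx).II]
  simp only [h.nablaForm_eq hx, h.inner_skew hx, inner_add_right, inner_sub_right]
  ring

/-- Multiplication by `2n` removes the normalization of `lambdaForm`, also in dimension zero. -/
lemma two_mul_smul_act_lambdaForm (A B C : EndField n M) (x : M) :
    (2 * n : ℝ) • act (A x) (lambdaForm B C x) = act (A x) (fun X : Fin 1 → _ ↦
      formInner (insertFirst (X 0) (nablaForm (kahlerForm B) x)) (kahler C x)) := by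
  rw [← map_smul]
  congr 1
  ext X
  change (2 * n : ℝ) * (1 / (2 * n : ℝ) * _) = _
  rcases eq_or_ne n 0 with rfl | hn
  · have hr : Module.finrank ℝ (TangentSpace (𝓡 (4 * 0)) x) = 0 := finrank_euclideanSpace_fin
    have : IsEmpty (Fin (Module.finrank ℝ (TangentSpace (𝓡 (4 * 0)) x))) := by
      rw [hr]; infer_instance
    simp [formInner]
  · have : (n : ℝ) ≠ 0 := by exact_mod_cast hn
    field_simp

end AdaptedBasis

end QuaternionHermitian

theorem mainTheorem1 {n : ℕ} {M : Type*} [TopologicalSpace M]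
    [ChartedSpace (EuclideanSpace ℝ (Fin (4 * n))) M]
    [IsManifold (𝓡 (4 * n)) ∞ M]
    [RiemannianBundle (fun x : M ↦ TangentSpace (𝓡 (4 * n)) x)]
    [IsContMDiffRiemannianBundle (𝓡 (4 * n)) ∞
      (EuclideanSpace ℝ (Fin (4 * n)))
      (fun x : M ↦ TangentSpace (𝓡 (4 * n)) x)]
    (Q : AlmostQuaternionHermitian n M) (U : Set M) (I₀ J₀ K₀ : EndField n M)
    (hadapted : IsAdaptedBasis Q.G U I₀ J₀ K₀)
    -- the given adapted basis or one of its cyclic permutations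
    (I J K : EndField n M)
    (hcyclic : (I, J, K) = (I₀, J₀, K₀) ∨ (I, J, K) = (J₀, K₀, I₀) ∨ (I, J, K) = (K₀, I₀, J₀))
    (x : M) (hx : x ∈ U) :
    -- the covariant derivative of `ω_I`
    ((2 : ℝ) • nablaForm (kahlerForm I) x =
        (1 - slot (I x) 1 * slot (I x) 2) (dKahler I x)
          + (slot (I x) 1 + slot (I x) 2) (slot (J x) 0 (dKahler J x))
          - (1 - slot (I x) 1 * slot (I x) 2) (slot (J x) 0 (dKahler K x)) ∧
      (2 : ℝ) • nablaForm (kahlerForm I) x =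
        (1 - slot (I x) 1 * slot (I x) 2) (dKahler I x)
          + (slot (I x) 1 + slot (I x) 2) (slot (K x) 0 (dKahler K x))
          + (1 - slot (I x) 1 * slot (I x) 2) (slot (K x) 0 (dKahler J x))) ∧
    -- the Nijenhuis tensor of `I`
    ((2 : ℝ) • nijenhuis₃ I x =
        (pairSum (I x) - 1)
          ((slot (J x) 1 * slot (J x) 2) (act (J x) (dKahler J x) - act (K x) (dKahler K x))) ∧
      (2 : ℝ) • nijenhuis₃ I x =
        (1 - slot (I x) 0 * slot (I x) 1)
          ((slot (K x) 1 * slot (K x) 2 - slot (J x) 1 * slot (J x) 2)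
            (act (J x) (dKahler J x) - act (K x) (dKahler K x)))) ∧
    -- the one-form `I λ_I`
    ((2 * n : ℝ) • act (I x) (lambdaForm J K x) =
        act (I x) (contract (kahler K x) (dKahler J x))
          + act (J x) (contract (kahler K x) (dKahler I x))
          + act (J x) (contract (kahler I x) (dKahler K x)) ∧
      (2 * n : ℝ) • act (I x) (lambdaForm J K x) =
        act (I x) (contract (kahler K x) (dKahler J x))
          + contract (kahler I x) (dKahler I x) - contract (kahler K x) (dKahler K x)) ∧
    -- the three-form `J dω_J + K dω_K` has type `{2,1}` with respect to `I`
    (IsTypeTwoOne (I x) (act (J x) (dKahler J x) + act (K x) (dKahler K x)) ∧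
      pairSum (I x) (act (J x) (dKahler J x) + act (K x) (dKahler K x)) =
        act (J x) (dKahler J x) + act (K x) (dKahler K x)) := by
  have h : IsAdaptedBasis Q.G U I J K := by
    simp only [Prod.mk.injEq] at hcyclic
    rcases hcyclic with ⟨rfl, rfl, rfl⟩ | ⟨rfl, rfl, rfl⟩ | ⟨rfl, rfl, rfl⟩
    exacts [hadapted, hadapted.rotate, hadapted.rotate.rotate]
  have q := h.quaternionRelations hx
  have hI := h.isCommutatorTensor hx
  have hJ := h.rotate.isCommutatorTensor hx
  have hK := h.rotate.rotate.isCommutatorTensor hx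
  -- the three Kähler forms share the potential
  rw [potential_rotate] at hJ
  rw [potential_rotate, potential_rotate] at hK
  rw [two_mul_smul_act_lambdaForm]
  have hpair := pairSum_act_add_act_eq q hJ hK
  exact ⟨⟨two_nabla_eq q hI hJ hK, two_nabla_eq' q hI hJ hK⟩,
    ⟨two_nijenhuis_eq q hI hJ hK (h.nijenhuis₃_eq hx),
      two_nijenhuis_eq' q hI hJ hK (h.nijenhuis₃_eq hx)⟩,
    act_lambda_eq q (h.inner_skew hx) (h.rotate.rotate.inner_skew hx) (h.kahler_apply hx)
      (h.rotate.rotate.kahler_apply hx) hI hJ hK,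
    isTypeTwoOne_of_pairSum_eq q.II (exists_alternatingMap_act_add_act J K x) hpair, hpair⟩
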